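/- Let $(V,\omega)$ be a finite-dimensional real symplectic vector space, let $\Lambda=\Lambda(V)$ be its lagrangian grassmannian (the manifold of lagrangian subspaces of $V$), and fix $L_0\in\Lambda$. Let $\Sigma=\{L\in\Lambda : L\cap L_0\neq 0\}$ be the Maslov cycle relative to $L_0$. The smooth structure of $\Lambda$ and its tangent spaces are described as follows. If $L$ and $N$ are complementary lagrangian subspaces, every lagrangian subspace $M$ transversal to $N$ is the graph of a linear map $L\to N\cong L^*$ (where $y\in N$ is identified with $\omega(\cdot,y)|_L$) associated with a unique symmetric bilinear form $\rho_N(M)$ on $L$. The maps $\rho_N$ are the charts of $\Lambda$, and the differential of $\rho_N$ at $L$ identifies $T_L\Lambda$ with the space $S^2(L)$ of symmetric bilinear forms on $L$, independently of $N$. For $v\in L$, let $v\circledcirc v\in T_L^*\Lambda$ be the covector whose value on the tangent vector corresponding to $A\in S^2(L)$ is $A(v,v)$. Let $$\mathcal S=\{(L,-v\circledcirc v) : L\in\Lambda,\ v\in L\cap L_0,\ v\neq 0\}\subset T^*\Lambda .$$ **Theorem.** The set $\mathcal S$ lies in the punctured cotangent bundle $\dot T^*\Lambda$ (the complement of the zero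 section), its image under the projection $T^*\Lambda\to\Lambda$ is $\Sigma$, and $\mathcal S$ is a smooth (embedded) lagrangian submanifold of $\dot T^*\Lambda$ for the canonical symplectic form; it is closed in $\dot T^*\Lambda$ and conic, i.e. invariant under multiplication by positive scalars in the fibres. -/

import Mathlib

open Bundle Module
open scoped Manifold ContDiff Topology

noncomputable section

/-! ### Linear symplectic geometry -/

/-- A symplectic form on a real vector space: an alternating nondegenerate bilinear form. -/
structure SymplecticForm (V : Type*) [AddCommGroup V] [Module ℝ V] where
  /-- the underlying bilinear form -/
  form : LinearMap.BilinForm ℝ V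
  isAlt : form.IsAlt
  nondegenerate : form.Nondegenerate

/-- A subspace is lagrangian for a bilinear form if it equals its own orthogonal. -/
def IsLagrangian {V : Type*} [AddCommGroup V] [Module ℝ V] (B : LinearMap.BilinForm ℝ V)
    (W : Submodule ℝ V) : Prop :=
  B.orthogonal W = W

/-- The lagrangian grassmannian `Λ(V)` of a symplectic vector space. -/
@[ext]
structure LagrangianGrassmannian {V : Type*} [AddCommGroup V] [Module ℝ V]
    (σ : SymplecticForm V) where
  /-- the underlying linear subspace -/
  carrier : Submodule ℝ V
  isLagrangian : IsLagrangian σ.form carrier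

/-- The canonical symplectic form `∑ dqᵢ ∧ dpᵢ` of `E × E*`:
`((q, p), (q', p')) ↦ p'(q) - p(q')`. -/
def stdForm (E : Type*) [NormedAddCommGroup E] [NormedSpace ℝ E] :
    LinearMap.BilinForm ℝ (E × (E →L[ℝ] ℝ)) :=
  LinearMap.mk₂ ℝ (fun u w => w.2 u.1 - u.2 w.1)
    (by intros; simp; ring) (by intros; simp; ring) (by intros; simp; ring)
    (by intros; simp; ring)

@[simp]
theorem stdForm_apply {E : Type*} [NormedAddCommGroup E] [NormedSpace ℝ E]
    (u w : E × (E →L[ℝ] ℝ)) : stdForm E u w = w.2 u.1 - u.2 w.1 := rfl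

/-! ### Cotangent bundles and their lagrangian submanifolds -/

section Cotangent

variable {E : Type*} [NormedAddCommGroup E] [NormedSpace ℝ E]
  {M : Type*} [TopologicalSpace M] [ChartedSpace E M] [IsManifold 𝓘(ℝ, E) ∞ M]

/-- The cotangent space `T*_x M`. -/
abbrev CotangentSpace (E : Type*) [NormedAddCommGroup E] [NormedSpace ℝ E]
    {M : Type*} [TopologicalSpace M] [ChartedSpace E M] (x : M) : Type _ :=
  TangentSpace 𝓘(ℝ, E) x →L[ℝ] Bundle.Trivial M ℝ x

/-- The cotangent bundle `T*M`, with the topology and the manifold structure of the bundle of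
continuous linear maps from the tangent bundle to the trivial line bundle. -/
abbrev CotangentBundle (E : Type*) [NormedAddCommGroup E] [NormedSpace ℝ E]
    (M : Type*) [TopologicalSpace M] [ChartedSpace E M] : Type _ :=
  TotalSpace (E →L[ℝ] ℝ) (fun x : M => CotangentSpace E x)

/-- The model with corners (here: without boundary) of `T*M`. -/
abbrev cotangentModel (E : Type*) [NormedAddCommGroup E] [NormedSpace ℝ E] :
    ModelWithCorners ℝ (E × (E →L[ℝ] ℝ)) (ModelProd E (E →L[ℝ] ℝ)) :=
  𝓘(ℝ, E).prod 𝓘(ℝ, E →L[ℝ] ℝ)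

/-- The canonical symplectic form of `T*M` at the point `z`. The chart `extChartAt` of `T*M` at `z`
is the cotangent lift of a chart of `M`, that is, it gives canonical coordinates `(q, p)`, and the
form is `∑ dqᵢ ∧ dpᵢ` in these coordinates. -/
def canonicalForm (z : CotangentBundle E M) :
    LinearMap.BilinForm ℝ (TangentSpace (cotangentModel E) z) :=
  let D : TangentSpace (cotangentModel E) z →L[ℝ] E × (E →L[ℝ] ℝ) :=
    mfderiv (cotangentModel E) 𝓘(ℝ, E × (E →L[ℝ] ℝ)) (extChartAt (cotangentModel E) z) z
  (stdForm E).comp D.toLinearMap D.toLinearMap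

/-- `e` is a smooth chart of the manifold `P` around `p` that straightens the subset `S`:
in the domain of `e`, the set `S` corresponds to the linear subspace `F`. -/
structure IsSliceChart {E' : Type*} [NormedAddCommGroup E'] [NormedSpace ℝ E']
    {H : Type*} [TopologicalSpace H] (I : ModelWithCorners ℝ E' H)
    {P : Type*} [TopologicalSpace P] [ChartedSpace H P]
    (S : Set P) (p : P) (e : OpenPartialHomeomorph P H) (F : Submodule ℝ E') : Prop where
  mem_maximalAtlas : e ∈ IsManifold.maximalAtlas I ∞ P
  mem_source : p ∈ e.source
  mem_iff : ∀ q ∈ e.source, q ∈ S ↔ e.extend I q ∈ F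

/-- `S` is a smooth (embedded) lagrangian submanifold of `T*M`: near each of its points it is
straightened by a chart of `T*M`, and its tangent space there, which is the preimage of the
straightening linear subspace under the derivative of the chart, is lagrangian. -/
def IsLagrangianSubmanifold (S : Set (CotangentBundle E M)) : Prop :=
  ∀ z ∈ S, ∃ (e : OpenPartialHomeomorph (CotangentBundle E M) (ModelProd E (E →L[ℝ] ℝ)))
    (F : Submodule ℝ (E × (E →L[ℝ] ℝ))),
    IsSliceChart (cotangentModel E) S z e F ∧
    IsLagrangian (canonicalForm z)
      (F.comap (mfderiv (cotangentModel E) 𝓘(ℝ, E × (E →L[ℝ] ℝ))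
        (e.extend (cotangentModel E)) z).toLinearMap)

/-- The punctured cotangent bundle: the complement of the zero section. -/
def puncturedCotangent (E : Type*) [NormedAddCommGroup E] [NormedSpace ℝ E]
    (M : Type*) [TopologicalSpace M] [ChartedSpace E M] : Set (CotangentBundle E M) :=
  {z | z.2 ≠ 0}

/-- A subset of `T*M` is conic if it is invariant under multiplication by positive scalars in
the fibres. -/
def IsConic (S : Set (CotangentBundle E M)) : Prop :=
  ∀ z ∈ S, ∀ t : ℝ, 0 < t → (⟨z.1, t • z.2⟩ : CotangentBundle E M) ∈ S

end Cotangent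

/-! ### The smooth structure of the lagrangian grassmannian -/

-- Mathlib's instances (the operator norm), registered as shortcuts for instance search.
instance (n : ℕ) : NormedAddCommGroup
    (EuclideanSpace ℝ (Fin n) →L[ℝ] EuclideanSpace ℝ (Fin n) →L[ℝ] ℝ) :=
  ContinuousLinearMap.toNormedAddCommGroup

instance (n : ℕ) : NormedSpace ℝ
    (EuclideanSpace ℝ (Fin n) →L[ℝ] EuclideanSpace ℝ (Fin n) →L[ℝ] ℝ) :=
  ContinuousLinearMap.toNormedSpace

/-- The subspace of the symmetric bilinear forms on `ℝⁿ`. -/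
def symFormsSubmodule (n : ℕ) :
    Submodule ℝ (EuclideanSpace ℝ (Fin n) →L[ℝ] EuclideanSpace ℝ (Fin n) →L[ℝ] ℝ) where
  carrier := {A | ∀ x y, A x y = A y x}
  add_mem' hA hB x y := by simp [hA x y, hB x y]
  zero_mem' x y := by simp
  smul_mem' c A hA x y := by simp [hA x y]

/-- The space `S²(ℝⁿ)` of symmetric bilinear forms on `ℝⁿ`, with the operator norm. -/
def SymForms (n : ℕ) : Type := symFormsSubmodule n

instance (n : ℕ) : NormedAddCommGroup (SymForms n) :=
  Submodule.normedAddCommGroup (symFormsSubmodule n)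

instance (n : ℕ) : NormedSpace ℝ (SymForms n) :=
  Submodule.normedSpace (symFormsSubmodule n)

instance (n : ℕ) : FiniteDimensional ℝ (SymForms n) :=
  inferInstanceAs (FiniteDimensional ℝ (symFormsSubmodule n))

/-- A symmetric bilinear form as a bilinear form. -/
def SymForms.toForm {n : ℕ} : SymForms n →L[ℝ]
    (EuclideanSpace ℝ (Fin n) →L[ℝ] EuclideanSpace ℝ (Fin n) →L[ℝ] ℝ) :=
  (symFormsSubmodule n).subtypeL

theorem SymForms.toForm_symm {n : ℕ} (A : SymForms n) (x y : EuclideanSpace ℝ (Fin n)) :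
    toForm A x y = toForm A y x :=
  A.2 x y

theorem SymForms.toForm_injective {n : ℕ} : Function.Injective (toForm (n := n)) :=
  Subtype.val_injective

/-- A bilinear form that is symmetric, as a symmetric bilinear form. -/
def SymForms.mk {n : ℕ} (A : EuclideanSpace ℝ (Fin n) →L[ℝ] EuclideanSpace ℝ (Fin n) →L[ℝ] ℝ)
    (hA : ∀ x y, A x y = A y x) : SymForms n :=
  ⟨A, hA⟩

@[simp]
theorem SymForms.toForm_mk {n : ℕ}
    (A : EuclideanSpace ℝ (Fin n) →L[ℝ] EuclideanSpace ℝ (Fin n) →L[ℝ] ℝ)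
    (hA : ∀ x y, A x y = A y x) : toForm (mk A hA) = A := rfl

section Grassmannian

variable {V : Type*} [AddCommGroup V] [Module ℝ V]

/-- Half of the dimension of `V`. -/
abbrev halfDim (V : Type*) [AddCommGroup V] [Module ℝ V] : ℕ := finrank ℝ V / 2

/-- The coordinate space `ℝⁿ`, where `2n = dim V`. -/
abbrev QSpace (V : Type*) [AddCommGroup V] [Module ℝ V] : Type :=
  EuclideanSpace ℝ (Fin (halfDim V))

/-- A symplectic linear identification of `V` with `T*ℝⁿ = ℝⁿ × (ℝⁿ)*`. It amounts to the choice of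
a lagrangian subspace `L` (the preimage of `ℝⁿ × 0`), a lagrangian complement `N` of `L` (the
preimage of `0 × (ℝⁿ)*`), and a basis of `L`. -/
structure Frame (σ : SymplecticForm V) where
  /-- the linear identification -/
  toEquiv : V ≃ₗ[ℝ] QSpace V × (QSpace V →L[ℝ] ℝ)
  symplectic : ∀ u w, stdForm (QSpace V) (toEquiv u) (toEquiv w) = σ.form u w

namespace Frame

variable {σ : SymplecticForm V} (φ : Frame σ)

/-- The lagrangian subspace `N` corresponding to `0 × (ℝⁿ)*`. -/
def fibre : Submodule ℝ V :=
  LinearMap.ker (LinearMap.fst ℝ _ _ ∘ₗ φ.toEquiv.toLinearMap)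

theorem mem_fibre {u : V} : u ∈ φ.fibre ↔ (φ.toEquiv u).1 = 0 := Iff.rfl

/-- The lagrangian subspace corresponding to the graph of the symmetric operator
`ℝⁿ → (ℝⁿ)*` associated with the symmetric form `A`. -/
def graph (A : SymForms (halfDim V)) : LagrangianGrassmannian σ where
  carrier := (LinearMap.graph (SymForms.toForm A).toLinearMap).comap φ.toEquiv.toLinearMap
  isLagrangian := by
    ext u
    simp only [LinearMap.BilinForm.mem_orthogonal_iff, Submodule.mem_comap, LinearMap.mem_graph_iff,
      LinearEquiv.coe_coe, ContinuousLinearMap.coe_coe, ← φ.symplectic, stdForm_apply]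
    constructor
    · intro h
      ext x
      have h1 := h (φ.toEquiv.symm (x, SymForms.toForm A x))
      simp only [LinearEquiv.apply_symm_apply, forall_const] at h1
      rw [SymForms.toForm_symm A x] at h1
      linarith
    · intro h w hw
      rw [h, hw, SymForms.toForm_symm]
      ring

theorem mem_graph {A : SymForms (halfDim V)} {u : V} :
    u ∈ (φ.graph A).carrier ↔ (φ.toEquiv u).2 = SymForms.toForm A (φ.toEquiv u).1 := Iff.rfl

theorem graph_injective : Function.Injective φ.graph := by
  intro A B h
  refine SymForms.toForm_injective (ContinuousLinearMap.ext fun x => ?_)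
  have h1 : φ.toEquiv.symm (x, SymForms.toForm A x) ∈ (φ.graph A).carrier := by simp [mem_graph]
  rw [h] at h1
  simpa [mem_graph] using h1

theorem isCompl_graph (A : SymForms (halfDim V)) : IsCompl (φ.graph A).carrier φ.fibre := by
  constructor
  · rw [Submodule.disjoint_def]
    intro u h1 h2
    rw [mem_graph] at h1
    rw [mem_fibre] at h2
    apply φ.toEquiv.injective
    ext1
    · simp [h2]
    · simp [h1, h2]
  · rw [codisjoint_iff, eq_top_iff]
    intro u _
    rw [Submodule.mem_sup]
    refine ⟨φ.toEquiv.symm ((φ.toEquiv u).1, SymForms.toForm A (φ.toEquiv u).1), by simp [mem_graph],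
      φ.toEquiv.symm (0, (φ.toEquiv u).2 - SymForms.toForm A (φ.toEquiv u).1), by simp [mem_fibre], ?_⟩
    rw [← map_add]
    simp

theorem exists_graph_eq (M : LagrangianGrassmannian σ) (h : IsCompl M.carrier φ.fibre) :
    ∃ A, φ.graph A = M := by
  let p : M.carrier →ₗ[ℝ] QSpace V :=
    LinearMap.fst ℝ _ _ ∘ₗ φ.toEquiv.toLinearMap ∘ₗ M.carrier.subtype
  have hinj : Function.Injective p := by
    rw [← LinearMap.ker_eq_bot, LinearMap.ker_eq_bot']
    intro u hu
    exact Subtype.ext (Submodule.disjoint_def.1 h.disjoint u u.2 hu)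
  have hsurj : Function.Surjective p := by
    intro x
    have : φ.toEquiv.symm (x, 0) ∈ M.carrier ⊔ φ.fibre := by
      rw [codisjoint_iff.1 h.codisjoint]; trivial
    obtain ⟨u, hu, w, hw, huw⟩ := Submodule.mem_sup.1 this
    refine ⟨⟨u, hu⟩, ?_⟩
    have h1 : (φ.toEquiv (u + w)).1 = x := by rw [huw]; simp
    rw [map_add, Prod.fst_add, (φ.mem_fibre).1 hw, add_zero] at h1
    exact h1
  let e := LinearEquiv.ofBijective p ⟨hinj, hsurj⟩
  have hiso : ∀ u ∈ M.carrier, ∀ w ∈ M.carrier,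
      (φ.toEquiv w).2 (φ.toEquiv u).1 = (φ.toEquiv u).2 (φ.toEquiv w).1 := by
    intro u hu w hw
    have h1 : w ∈ σ.form.orthogonal M.carrier := by rw [M.isLagrangian]; exact hw
    have h2 := h1 u hu
    rw [← φ.symplectic, stdForm_apply] at h2
    linarith
  let A : QSpace V →L[ℝ] QSpace V →L[ℝ] ℝ := LinearMap.toContinuousLinearMap
    (LinearMap.snd ℝ _ _ ∘ₗ φ.toEquiv.toLinearMap ∘ₗ M.carrier.subtype ∘ₗ e.symm.toLinearMap)
  have he : ∀ x, (φ.toEquiv (e.symm x : V)).1 = x := fun x => e.apply_symm_apply x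
  have hA : ∀ x, A x = (φ.toEquiv (e.symm x : V)).2 := fun x => rfl
  have hsymm : ∀ x y, A x y = A y x := by
    intro x y
    have := hiso _ (e.symm x).2 _ (e.symm y).2
    rw [he, he] at this
    rw [hA, hA, this]
  refine ⟨SymForms.mk A hsymm, ?_⟩
  ext u
  rw [mem_graph, SymForms.toForm_mk]
  refine ⟨fun hu => ?_, fun hu => ?_⟩
  · have h1 : φ.toEquiv (e.symm (φ.toEquiv u).1 : V) = φ.toEquiv u :=
      Prod.ext (he _) hu.symm
    rw [← φ.toEquiv.injective h1]
    exact (e.symm _).2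
  · have : e.symm (φ.toEquiv u).1 = ⟨u, hu⟩ := e.symm_apply_apply ⟨u, hu⟩
    simp only [hA, this]

open Classical in
/-- The chart `ρ_N` of `Λ`: it is defined on the set of the lagrangian subspaces `M` that are
transversal to `N = φ.fibre`, and sends `M` to the symmetric form `A` such that `M` is the graph
of the operator associated with `A`. -/
def chart : PartialEquiv (LagrangianGrassmannian σ) (SymForms (halfDim V)) where
  toFun M := if h : IsCompl M.carrier φ.fibre then (φ.exists_graph_eq M h).choose else 0
  invFun := φ.graph
  source := {M | IsCompl M.carrier φ.fibre}
  target := Set.univ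
  map_source' _ _ := trivial
  map_target' A _ := φ.isCompl_graph A
  left_inv' M h := by
    simp only [Set.mem_ofPred_eq] at h
    rw [dif_pos h]
    exact (φ.exists_graph_eq M h).choose_spec
  right_inv' A _ := by
    rw [dif_pos (φ.isCompl_graph A)]
    exact φ.graph_injective (φ.exists_graph_eq _ (φ.isCompl_graph A)).choose_spec

/-- The change of frames from `φ` to `φ'`. -/
def change (φ φ' : Frame σ) : QSpace V × (QSpace V →L[ℝ] ℝ) →L[ℝ] QSpace V × (QSpace V →L[ℝ] ℝ) :=
  LinearMap.toContinuousLinearMap (φ'.toEquiv.toLinearMap ∘ₗ φ.toEquiv.symm.toLinearMap)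

theorem change_apply (φ φ' : Frame σ) (z : QSpace V × (QSpace V →L[ℝ] ℝ)) :
    change φ φ' z = φ'.toEquiv (φ.toEquiv.symm z) := rfl

/-- For `x ∈ ℝⁿ`, the base component in the frame `φ'` of the point over `x` of the graph of `A`
in the frame `φ`. -/
def transBase (φ φ' : Frame σ) (A : QSpace V →L[ℝ] QSpace V →L[ℝ] ℝ) :
    QSpace V →L[ℝ] QSpace V :=
  ContinuousLinearMap.fst ℝ _ _ ∘L change φ φ' ∘L
    (ContinuousLinearMap.inl ℝ _ _ + ContinuousLinearMap.inr ℝ _ _ ∘L A)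

/-- The fibre component in the frame `φ'` of the same point. -/
def transFibre (φ φ' : Frame σ) (A : QSpace V →L[ℝ] QSpace V →L[ℝ] ℝ) :
    QSpace V →L[ℝ] QSpace V →L[ℝ] ℝ :=
  ContinuousLinearMap.snd ℝ _ _ ∘L change φ φ' ∘L
    (ContinuousLinearMap.inl ℝ _ _ + ContinuousLinearMap.inr ℝ _ _ ∘L A)

theorem transBase_apply (φ φ' : Frame σ) (A : QSpace V →L[ℝ] QSpace V →L[ℝ] ℝ) (x : QSpace V) :
    transBase φ φ' A x = (φ'.toEquiv (φ.toEquiv.symm (x, A x))).1 := by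
  rw [← change_apply]
  simp only [transBase, ContinuousLinearMap.comp_apply, ContinuousLinearMap.coe_fst']
  congr 2
  simp

theorem transFibre_apply (φ φ' : Frame σ) (A : QSpace V →L[ℝ] QSpace V →L[ℝ] ℝ) (x : QSpace V) :
    transFibre φ φ' A x = (φ'.toEquiv (φ.toEquiv.symm (x, A x))).2 := by
  rw [← change_apply]
  simp only [transFibre, ContinuousLinearMap.comp_apply, ContinuousLinearMap.coe_snd']
  congr 2
  simp

theorem contDiff_transBase (φ φ' : Frame σ) : ContDiff ℝ ∞ (transBase φ φ') := by
  unfold transBase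
  fun_prop

theorem contDiff_transFibre (φ φ' : Frame σ) : ContDiff ℝ ∞ (transFibre φ φ') := by
  unfold transFibre
  fun_prop

/-- The transition formula `B = (c + d A) (a + b A)⁻¹` between two charts. -/
theorem transFibre_eq (φ φ' : Frame σ) {A B : SymForms (halfDim V)}
    (h : φ.graph A = φ'.graph B) : transFibre φ φ' (SymForms.toForm A) = SymForms.toForm B ∘L transBase φ φ' (SymForms.toForm A) := by
  ext x : 1
  have h1 : φ.toEquiv.symm (x, SymForms.toForm A x) ∈ (φ.graph A).carrier := by simp [mem_graph]
  rw [h, mem_graph] at h1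
  rw [transFibre_apply, h1, ContinuousLinearMap.comp_apply, transBase_apply]

theorem isCompl_iff (φ φ' : Frame σ) (A : SymForms (halfDim V)) :
    IsCompl (φ.graph A).carrier φ'.fibre ↔ IsUnit (transBase φ φ' (SymForms.toForm A)) := by
  rw [ContinuousLinearMap.isUnit_iff_bijective]
  constructor
  · intro h
    have hinj : Function.Injective (transBase φ φ' (SymForms.toForm A)) := by
      rw [injective_iff_map_eq_zero]
      intro x hx
      rw [transBase_apply] at hx
      have h1 : φ.toEquiv.symm (x, SymForms.toForm A x) ∈ (φ.graph A).carrier := by simp [mem_graph]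
      have h2 := Submodule.disjoint_def.1 h.disjoint _ h1 hx
      rw [LinearEquiv.map_eq_zero_iff, Prod.mk_eq_zero] at h2
      exact h2.1
    exact ⟨hinj, (LinearMap.injective_iff_surjective
      (f := (transBase φ φ' (SymForms.toForm A)).toLinearMap)).1 hinj⟩
  · intro h
    constructor
    · rw [Submodule.disjoint_def]
      intro u h1 h2
      rw [mem_graph] at h1
      rw [mem_fibre] at h2
      have h3 : φ.toEquiv.symm ((φ.toEquiv u).1, SymForms.toForm A (φ.toEquiv u).1) = u := by
        rw [← h1]; simp
      have h4 : transBase φ φ' (SymForms.toForm A) (φ.toEquiv u).1 = 0 := by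
        rw [transBase_apply, h3, h2]
      have h5 := (injective_iff_map_eq_zero _).1 h.1 _ h4
      rw [h5] at h3
      rw [← h3, map_zero]
      exact map_zero φ.toEquiv.symm
    · rw [codisjoint_iff, eq_top_iff]
      intro u _
      obtain ⟨x, hx⟩ := h.2 (φ'.toEquiv u).1
      rw [transBase_apply] at hx
      rw [Submodule.mem_sup]
      refine ⟨φ.toEquiv.symm (x, SymForms.toForm A x), by simp [mem_graph],
        u - φ.toEquiv.symm (x, SymForms.toForm A x), ?_, by abel⟩
      rw [mem_fibre, map_sub, Prod.fst_sub, hx, sub_self]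

theorem trans_source (φ φ' : Frame σ) : (φ.chart.symm.trans φ'.chart).source =
    {A | IsUnit (transBase φ φ' (SymForms.toForm A))} := by
  ext A
  rw [PartialEquiv.trans_source]
  simp only [PartialEquiv.symm_source, Set.mem_inter_iff, Set.mem_preimage]
  exact ⟨fun h => (isCompl_iff φ φ' A).1 h.2, fun h => ⟨trivial, (isCompl_iff φ φ' A).2 h⟩⟩

theorem isOpen_trans_source (φ φ' : Frame σ) :
    IsOpen (φ.chart.symm.trans φ'.chart).source := by
  rw [trans_source]
  exact Units.isOpen.preimage ((contDiff_transBase φ φ').continuous.comp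
    (SymForms.toForm (n := halfDim V)).continuous)

/-- The symmetrization of a bilinear form. -/
def symmetrize (n : ℕ) :
    (EuclideanSpace ℝ (Fin n) →L[ℝ] EuclideanSpace ℝ (Fin n) →L[ℝ] ℝ) →L[ℝ] SymForms n :=
  ((2⁻¹ : ℝ) • (ContinuousLinearMap.id ℝ _ +
    (ContinuousLinearMap.flipₗᵢ ℝ (EuclideanSpace ℝ (Fin n)) (EuclideanSpace ℝ (Fin n))
      ℝ).toContinuousLinearEquiv.toContinuousLinearMap)).codRestrict (symFormsSubmodule n) (by
    intro A x y
    change (2⁻¹ : ℝ) * (A x y + A y x) = 2⁻¹ * (A y x + A x y)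
    ring)

theorem symmetrize_coe {n : ℕ} (A : SymForms n) : symmetrize n (SymForms.toForm A) = A := by
  refine SymForms.toForm_injective (ContinuousLinearMap.ext fun x => ContinuousLinearMap.ext fun y => ?_)
  have h : SymForms.toForm A y x = SymForms.toForm A x y := SymForms.toForm_symm A y x
  change (2⁻¹ : ℝ) * (SymForms.toForm A x y + SymForms.toForm A y x) = SymForms.toForm A x y
  rw [h]
  ring

theorem contDiffOn_trans (φ φ' : Frame σ) :
    ContDiffOn ℝ ∞ (φ.chart.symm.trans φ'.chart) (φ.chart.symm.trans φ'.chart).source := by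
  have hEq : ∀ A ∈ (φ.chart.symm.trans φ'.chart).source, (φ.chart.symm.trans φ'.chart) A =
      symmetrize (halfDim V)
        (transFibre φ φ' (SymForms.toForm A) ∘L Ring.inverse (transBase φ φ' (SymForms.toForm A))) := by
    intro A hA
    have h1 : φ.graph A = φ'.graph ((φ.chart.symm.trans φ'.chart) A) :=
      (φ'.chart.left_inv ((PartialEquiv.trans_source _ _ ▸ hA).2)).symm
    rw [transFibre_eq φ φ' h1]
    rw [trans_source] at hA
    rw [ContinuousLinearMap.comp_assoc]
    have h2 : transBase φ φ' (SymForms.toForm A) ∘L Ring.inverse (transBase φ φ' (SymForms.toForm A)) =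
        ContinuousLinearMap.id ℝ _ := Ring.mul_inverse_cancel _ hA
    rw [h2, ContinuousLinearMap.comp_id, symmetrize_coe]
  refine ContDiffOn.congr ?_ hEq
  intro A hA
  rw [trans_source] at hA
  apply ContDiffAt.contDiffWithinAt
  have hs : ContDiff ℝ ∞ (fun A : SymForms (halfDim V) => SymForms.toForm A) :=
    (SymForms.toForm (n := halfDim V)).contDiff
  have h1 : ContDiffAt ℝ ∞ (fun A : SymForms (halfDim V) => transFibre φ φ' (SymForms.toForm A)) A :=
    ((contDiff_transFibre φ φ').comp hs).contDiffAt
  have h2 : ContDiffAt ℝ ∞ (fun A : SymForms (halfDim V) => transBase φ φ' (SymForms.toForm A)) A :=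
    ((contDiff_transBase φ φ').comp hs).contDiffAt
  obtain ⟨u, hu⟩ : IsUnit (transBase φ φ' (SymForms.toForm A)) := hA
  have h3 : ContDiffAt ℝ ∞ (Ring.inverse : (QSpace V →L[ℝ] QSpace V) → _)
      (transBase φ φ' (SymForms.toForm A)) := by
    rw [← hu]
    exact contDiffAt_ringInverse ℝ u
  have h4 : ContDiffAt ℝ ∞ (fun A : SymForms (halfDim V) =>
      Ring.inverse (transBase φ φ' (SymForms.toForm A))) A :=
    ContDiffAt.comp (g := fun k : QSpace V →L[ℝ] QSpace V => Ring.inverse k) A h3 h2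
  exact (symmetrize _).contDiff.contDiffAt.comp A (h1.clm_comp h4)

end Frame

variable [FiniteDimensional ℝ V] {σ : SymplecticForm V}

/-- Every lagrangian subspace is the zero section for some frame. -/
theorem exists_frame (L : LagrangianGrassmannian σ) : ∃ φ : Frame σ, φ.graph 0 = L := by
  have hdim : finrank ℝ L.carrier + finrank ℝ L.carrier = finrank ℝ V := by
    have h1 := LinearMap.BilinForm.finrank_orthogonal σ.nondegenerate L.carrier
    have h2 := Submodule.finrank_le L.carrier
    have h3 := L.isLagrangian
    rw [IsLagrangian] at h3
    rw [h3] at h1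
    omega
  have hL : finrank ℝ L.carrier = halfDim V := by unfold halfDim; omega
  have hiso : ∀ u ∈ L.carrier, ∀ w ∈ L.carrier, σ.form u w = 0 := by
    intro u hu w hw
    have h1 : w ∈ σ.form.orthogonal L.carrier := by rw [L.isLagrangian]; exact hw
    exact h1 u hu
  have hskew : ∀ u w, σ.form u w = - σ.form w u := fun u w => (σ.isAlt.neg_eq w u).symm
  let b : L.carrier ≃ₗ[ℝ] QSpace V := LinearEquiv.ofFinrankEq _ _ (by simp [hL])
  obtain ⟨p₀, hp₀⟩ := L.carrier.subtype.exists_leftInverse_of_injective L.carrier.ker_subtype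
  let p : V →ₗ[ℝ] V := L.carrier.subtype ∘ₗ p₀
  let q : V →ₗ[ℝ] V := LinearMap.id - p
  have hp : ∀ u ∈ L.carrier, p u = u := fun u hu =>
    congrArg Subtype.val (LinearMap.congr_fun hp₀ ⟨u, hu⟩)
  have hpL : ∀ u, p u ∈ L.carrier := fun u => (p₀ u).2
  have hpq : ∀ u, u = p u + q u := fun u => by simp [q]
  have hq : ∀ u ∈ L.carrier, q u = 0 := fun u hu => by simp [q, hp u hu]
  let f : LinearMap.BilinForm ℝ V :=
    σ.form.comp p LinearMap.id + (2⁻¹ : ℝ) • σ.form.comp q q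
  have hf : ∀ u w, f u w = σ.form (p u) w + 2⁻¹ * σ.form (q u) (q w) := fun u w => by simp [f]
  let g₀ : V →ₗ[ℝ] V := (σ.form.toDual σ.nondegenerate).symm.toLinearMap ∘ₗ f
  have hg₀ : ∀ u w, σ.form (g₀ u) w = f u w := fun u w =>
    LinearMap.BilinForm.apply_toDual_symm_apply (hB := σ.nondegenerate) (f := f u) (v := w)
  have hg₀L : ∀ u, g₀ u ∈ L.carrier := by
    intro u
    have h1 : g₀ u ∈ σ.form.orthogonal L.carrier := by
      intro w hw
      change σ.form w (g₀ u) = 0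
      rw [hskew, hg₀, hf, hq w hw, hiso _ (hpL u) w hw]
      simp
    rwa [L.isLagrangian] at h1
  let g : V →ₗ[ℝ] L.carrier := g₀.codRestrict L.carrier hg₀L
  let ξ : V →ₗ[ℝ] QSpace V →L[ℝ] ℝ :=
    LinearMap.toContinuousLinearMap.toLinearMap ∘ₗ
      (σ.form.flip.compl₂ (L.carrier.subtype ∘ₗ b.symm.toLinearMap))
  have hξ : ∀ u x, ξ u x = σ.form (b.symm x : V) u := fun u x => rfl
  let T : V →ₗ[ℝ] QSpace V × (QSpace V →L[ℝ] ℝ) := (b.toLinearMap ∘ₗ g).prod ξ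
  have hT : ∀ u w, stdForm (QSpace V) (T u) (T w) = σ.form u w := by
    intro u w
    have e1 : (T w).2 (T u).1 = σ.form (g₀ u) w := by
      change ξ w (b (g u)) = _
      rw [hξ, LinearEquiv.symm_apply_apply]; rfl
    have e2 : (T u).2 (T w).1 = σ.form (g₀ w) u := by
      change ξ u (b (g w)) = _
      rw [hξ, LinearEquiv.symm_apply_apply]; rfl
    rw [stdForm_apply, e1, e2, hg₀, hg₀, hf, hf]
    have k1 : σ.form u w = σ.form (p u) w + (σ.form (q u) (p w) + σ.form (q u) (q w)) := by
      conv_lhs => rw [hpq u]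
      rw [map_add, LinearMap.add_apply]
      congr 1
      conv_lhs => rw [hpq w]
      rw [map_add]
    have k2 : σ.form (p w) u = - σ.form (q u) (p w) := by
      conv_lhs => rw [hpq u]
      rw [map_add, hiso _ (hpL w) _ (hpL u), zero_add, hskew]
    rw [k1, k2, hskew (q w) (q u)]
    ring
  have hinj : Function.Injective T := by
    rw [injective_iff_map_eq_zero]
    intro u hu
    refine σ.nondegenerate.1 u fun w => ?_
    rw [← hT, hu]
    simp
  have hfin : finrank ℝ V = finrank ℝ (QSpace V × (QSpace V →L[ℝ] ℝ)) := by
    have h1 : finrank ℝ (QSpace V →L[ℝ] ℝ) = halfDim V := by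
      rw [← (LinearMap.toContinuousLinearMap (𝕜 := ℝ) (E := QSpace V) (F' := ℝ)).finrank_eq]
      exact (Subspace.dual_finrank_eq (K := ℝ) (V := QSpace V)).trans (by simp)
    rw [Module.finrank_prod, h1]
    simp only [finrank_euclideanSpace, Fintype.card_fin]
    omega
  refine ⟨⟨LinearMap.linearEquivOfInjective T hinj hfin, hT⟩, ?_⟩
  ext u
  rw [Frame.mem_graph]
  change ξ u = 0 ↔ _
  constructor
  · intro h
    have h1 : u ∈ σ.form.orthogonal L.carrier := by
      intro w hw
      have := hξ u (b ⟨w, hw⟩)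
      rw [LinearEquiv.symm_apply_apply, h] at this
      exact this.symm
    rwa [L.isLagrangian] at h1
  · intro h
    ext x
    rw [hξ, hiso _ (b.symm x).2 _ h]
    rfl

/-- A frame for which `L` is the zero section. -/
def frameAt (L : LagrangianGrassmannian σ) : Frame σ := (exists_frame L).choose

theorem graph_frameAt (L : LagrangianGrassmannian σ) : (frameAt L).graph 0 = L :=
  (exists_frame L).choose_spec

/-- The charts of the lagrangian grassmannian and their compatibility. -/
def lagrangianCore (σ : SymplecticForm V) :
    ChartedSpaceCore (SymForms (halfDim V)) (LagrangianGrassmannian σ) where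
  atlas := Set.range Frame.chart
  chartAt L := (frameAt L).chart
  mem_chart_source L := by
    have := (frameAt L).isCompl_graph 0
    rwa [graph_frameAt] at this
  chart_mem_atlas L := ⟨_, rfl⟩
  open_source := by
    rintro _ _ ⟨φ, rfl⟩ ⟨φ', rfl⟩
    exact Frame.isOpen_trans_source φ φ'
  continuousOn_toFun := by
    rintro _ _ ⟨φ, rfl⟩ ⟨φ', rfl⟩
    exact (Frame.contDiffOn_trans φ φ').continuousOn

instance (σ : SymplecticForm V) : TopologicalSpace (LagrangianGrassmannian σ) :=
  (lagrangianCore σ).toTopologicalSpace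

instance (σ : SymplecticForm V) :
    ChartedSpace (SymForms (halfDim V)) (LagrangianGrassmannian σ) :=
  (lagrangianCore σ).toChartedSpace

instance (σ : SymplecticForm V) :
    IsManifold 𝓘(ℝ, SymForms (halfDim V)) ∞ (LagrangianGrassmannian σ) := by
  apply isManifold_of_contDiffOn
  intro e e' he he'
  obtain ⟨_, ⟨_, rfl⟩, hf⟩ := he
  obtain ⟨⟨φ, rfl⟩, hφ⟩ := Set.mem_iUnion.1 hf
  obtain ⟨_, ⟨_, rfl⟩, hf'⟩ := he'
  obtain ⟨⟨φ', rfl⟩, hφ'⟩ := Set.mem_iUnion.1 hf'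
  obtain rfl := Set.mem_singleton_iff.1 hφ
  obtain rfl := Set.mem_singleton_iff.1 hφ'
  simp only [modelWithCornersSelf_coe, modelWithCornersSelf_coe_symm, Set.range_id,
    Set.inter_univ]
  exact Frame.contDiffOn_trans φ φ'

/-! ### The Maslov cycle and the set lying above it -/

/-- The identification of the tangent space `T_L Λ` with the symmetric forms on `L`, in the
coordinates of the basis of `L` given by the chosen frame: the differential at `L` of the chart
`ρ_N`, where `N` is a lagrangian complement of `L`. -/
def tangentToForm (L : LagrangianGrassmannian σ) :
    TangentSpace 𝓘(ℝ, SymForms (halfDim V)) L →L[ℝ] SymForms (halfDim V) :=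
  mfderiv 𝓘(ℝ, SymForms (halfDim V)) 𝓘(ℝ, SymForms (halfDim V)) (frameAt L).chart L

/-- The linear functional `A ↦ A(x, x)` on symmetric forms. -/
def evalQuad {n : ℕ} (x : EuclideanSpace ℝ (Fin n)) : SymForms n →L[ℝ] ℝ :=
  ContinuousLinearMap.apply ℝ ℝ x ∘L
    ContinuousLinearMap.apply ℝ (EuclideanSpace ℝ (Fin n) →L[ℝ] ℝ) x ∘L SymForms.toForm

/-- The covector `v ⊙ v` at `L`, for `v ∈ L`: its value on the tangent vector identified with the
symmetric form `A` on `L` is `A(v, v)`. -/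
def symSquare (L : LagrangianGrassmannian σ) (v : V) :
    CotangentSpace (SymForms (halfDim V)) L :=
  evalQuad ((frameAt L).toEquiv v).1 ∘L tangentToForm L

/-- The Maslov cycle `Σ` of `L₀`: the set of the `L ∈ Λ` with `L ∩ L₀ ≠ 0`. -/
def maslovCycle (L₀ : LagrangianGrassmannian σ) : Set (LagrangianGrassmannian σ) :=
  {L | L.carrier ⊓ L₀.carrier ≠ ⊥}

/-- The set `𝒮` of the pairs `(L, -v ⊙ v)` with `v` a nonzero vector of `L ∩ L₀`. -/
def maslovLift (L₀ : LagrangianGrassmannian σ) :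
    Set (CotangentBundle (SymForms (halfDim V)) (LagrangianGrassmannian σ)) :=
  {z | ∃ v ∈ z.1.carrier ⊓ L₀.carrier, v ≠ 0 ∧ z.2 = -symSquare z.1 v}

end Grassmannian

end

/-!
The proof is local on `Λ`. Fix `L ∈ Λ`, and use the frame `φ` at `L` to identify `V` with
`ℝⁿ × (ℝⁿ)*`; let `W` be the image of `L₀`. The chart of `T*Λ` at a point over `L` has values in
the pairs `(A, p)` with `A` a symmetric form and `p` a functional on symmetric forms.

*The set in coordinates.* If `M` is the graph of `A`, and `v ∈ M` is the point over `x`, then the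
covector `v ⊙ v` has the coordinate `x ⊙ x : H ↦ H(x, x)` in the chart of `φ`, although it is
defined by means of the frame at `M`. Indeed, when `A` moves with velocity `H`, the point over `x`
of its graph moves with velocity `(0, H x)`, and `H(x, x)` is the symplectic form evaluated at
the point and its velocity, which does not depend on the frame (`Frame.evalQuad_comp_fderiv_trans`).
Hence the union of `𝒮` and the zero section corresponds to the cone of the pairs `(A, -x ⊙ x)` with
`(x, A x) ∈ W` (`SymForms.conormalCone`, `mem_closedMaslovLift_iff`). The cone is closed, because
`‖x‖²` is the value of `x ⊙ x` at the inner product, so that `x` stays bounded when `x ⊙ x` does.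
So `𝒮` is closed in the punctured bundle.

*Smoothness.* Near `(0, -x ⊙ x)` with `x ≠ 0`, choose `e` with `⟨e, x⟩ = 1` and let `w` be the
linear function of `p` given by `⟨w, y⟩ = -p(e · y)`, where `e · y` is the symmetric product of the
linear forms `⟨e, ·⟩` and `⟨y, ·⟩`; at `p = -x ⊙ x` it is equal to `x`. Where `⟨w, e⟩ > 0`, the
cone is given by the polynomial equations `⟨w, e⟩ p + w ⊙ w = 0` and `(w, A w) ∈ W`. All values of
the left-hand sides lie in the image of their derivative at the point, so a local diffeomorphism
tangent to the identity straightens the cone onto the kernel of that derivative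
(`exists_openPartialHomeomorph_straightening_zeros`).

*The tangent space* is the space of the pairs `(H, -2 x ⊙ k)` with `(k, H x) ∈ W`, and it is its own
orthogonal because `W` is (`SymForms.isLagrangian_tangent_conormalCone`).
-/

noncomputable section

/-! ### Straightening the zeros of a smooth map -/

/-- If all values of `g` lie in the image of its derivative `g'` at `a`, then around `a` the zero
set of `g` is straightened onto the kernel of `g'` by a local diffeomorphism tangent to the identity:
`Φ y = y + j (g y - g' y)`, where `j` is a right inverse of `g'` on its image, satisfies
`g' (Φ y) = g y`. -/
theorem exists_openPartialHomeomorph_straightening_zeros {E G : Type*} [NormedAddCommGroup E]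
    [NormedSpace ℝ E] [FiniteDimensional ℝ E] [NormedAddCommGroup G] [NormedSpace ℝ G]
    [FiniteDimensional ℝ G] {g : E → G} (hg : ContDiff ℝ ∞ g) {a : E} {g' : E →L[ℝ] G}
    (hg' : HasFDerivAt g g' a) (hrange : ∀ y, g y ∈ LinearMap.range g'.toLinearMap)
    {U : Set E} (hU : IsOpen U) (ha : a ∈ U) :
    ∃ Φ : OpenPartialHomeomorph E E, a ∈ Φ.source ∧ Φ.source ⊆ U ∧
      ContDiffOn ℝ ∞ Φ Φ.source ∧ ContDiffOn ℝ ∞ Φ.symm Φ.target ∧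
      HasFDerivAt Φ (ContinuousLinearMap.id ℝ E) a ∧
      ∀ y, g y = 0 ↔ Φ y ∈ LinearMap.ker g'.toLinearMap := by
  -- a right inverse `j` of `g'` on its image, extended linearly to `G`
  obtain ⟨j, hj⟩ : ∃ j : G →L[ℝ] E, ∀ y ∈ LinearMap.range g'.toLinearMap, g' (j y) = y := by
    obtain ⟨s, hs⟩ := g'.toLinearMap.rangeRestrict.exists_rightInverse_of_surjective
      (LinearMap.range_rangeRestrict _)
    obtain ⟨t, ht⟩ := s.exists_extend
    refine ⟨LinearMap.toContinuousLinearMap t, fun y hy => ?_⟩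
    have h1 : t y = s ⟨y, hy⟩ := LinearMap.congr_fun ht ⟨y, hy⟩
    have h2 := congrArg Subtype.val (LinearMap.congr_fun hs ⟨y, hy⟩)
    change g' (t y) = y
    rw [h1]
    exact h2
  let f : E → E := fun y => y + j (g y - g' y)
  have hf : ContDiff ℝ ∞ f :=
    contDiff_id.add (j.contDiff.comp (hg.sub g'.contDiff))
  have hfa : HasFDerivAt f (ContinuousLinearMap.id ℝ E) a := by
    have := (hasFDerivAt_id a).add (j.hasFDerivAt.comp a (hg'.sub g'.hasFDerivAt))
    rw [sub_self, ContinuousLinearMap.comp_zero, add_zero] at this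
    exact this
  have hfa' : HasFDerivAt f ((ContinuousLinearEquiv.refl ℝ E : E ≃L[ℝ] E) : E →L[ℝ] E) a := hfa
  let Φ₀ := hf.contDiffAt.toOpenPartialHomeomorph f hfa' (by simp)
  -- where the derivative stays invertible, the local inverse is smooth as well
  let s : Set E := U ∩ {y | IsUnit (fderiv ℝ f y)}
  have hs : IsOpen s :=
    hU.inter (Units.isOpen.preimage (hf.continuous_fderiv (by simp)))
  refine ⟨Φ₀.restrOpen s hs, ⟨hf.contDiffAt.mem_toOpenPartialHomeomorph_source hfa' (by simp),
    ha, ?_⟩, fun y hy => hy.2.1, hf.contDiffOn, ?_, hfa, fun y => ?_⟩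
  · change IsUnit (fderiv ℝ f a)
    rw [hfa.fderiv]
    exact isUnit_one
  · intro y hy
    obtain ⟨u, hu⟩ : IsUnit (fderiv ℝ f (Φ₀.symm y)) := hy.2.2
    have h1 : HasFDerivAt Φ₀ ((ContinuousLinearEquiv.ofUnit u : E ≃L[ℝ] E) : E →L[ℝ] E)
        (Φ₀.symm y) := by
      have h2 := (hf.differentiable (by simp) (Φ₀.symm y)).hasFDerivAt
      rw [← hu] at h2
      exact h2
    exact (Φ₀.contDiffAt_symm hy.1 h1 hf.contDiffAt).contDiffWithinAt
  · change g y = 0 ↔ g' (y + j (g y - g' y)) = 0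
    have h1 : g' (j (g y - g' y)) = g y - g' y :=
      hj _ (Submodule.sub_mem _ (hrange y) ⟨y, rfl⟩)
    rw [map_add, h1, add_sub_cancel]

/-! ### Symmetric forms and quadratic covectors -/

namespace SymForms

variable {n : ℕ}

local notation "X" => EuclideanSpace ℝ (Fin n)

-- Mathlib's instances (the operator norm), registered as shortcuts for instance search.
instance : NormedAddCommGroup (SymForms n →L[ℝ] ℝ) := ContinuousLinearMap.toNormedAddCommGroup

instance : NormedSpace ℝ (SymForms n →L[ℝ] ℝ) := ContinuousLinearMap.toNormedSpace

instance : NormedAddCommGroup (X →L[ℝ] SymForms n →L[ℝ] ℝ) :=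
  ContinuousLinearMap.toNormedAddCommGroup

instance : NormedSpace ℝ (X →L[ℝ] SymForms n →L[ℝ] ℝ) := ContinuousLinearMap.toNormedSpace

/-- The functional `x ⊙ y : A ↦ A(x, y)` on symmetric forms, as a continuous bilinear map in
`x` and `y`. -/
def evalPair : X →L[ℝ] X →L[ℝ] SymForms n →L[ℝ] ℝ :=
  (ContinuousLinearMap.flipₗᵢ ℝ (SymForms n) X ℝ).toContinuousLinearEquiv.toContinuousLinearMap ∘L
    (toForm (n := n)).flip

@[simp]
theorem evalPair_apply (x y : X) (A : SymForms n) : evalPair x y A = toForm A x y := rfl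

theorem evalPair_self (x : X) : evalPair x x = evalQuad x := rfl

@[simp]
theorem evalQuad_apply (x : X) (A : SymForms n) : evalQuad x A = toForm A x x := rfl

/-- The symmetric product `(a ⊗ b + b ⊗ a) / 2` of the linear forms `⟨a, ·⟩` and `⟨b, ·⟩`,
linear in `b`. It is a form, while `evalPair a b` is a functional on forms. -/
def innerProd (a : X) : X →L[ℝ] SymForms n :=
  Frame.symmetrize n ∘L ContinuousLinearMap.smulRightL ℝ X (X →L[ℝ] ℝ) (innerSL ℝ a) ∘L innerSL ℝ

@[simp]
theorem toForm_innerProd (a b x y : X) : toForm (innerProd a b) x y =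
    2⁻¹ * (inner ℝ a x * inner ℝ b y + inner ℝ a y * inner ℝ b x) := rfl

/-- The vector `w` characterized by `⟨w, y⟩ = -p(innerProd e y)`. If `p` is the functional `-x ⊙ x`,
then `w = ⟨e, x⟩ x`, so that `p` determines `x` up to a factor. -/
def recover (e : X) : (SymForms n →L[ℝ] ℝ) →L[ℝ] X :=
  -((InnerProductSpace.toDual ℝ X).symm.toContinuousLinearEquiv.toContinuousLinearMap ∘L
    (ContinuousLinearMap.compL ℝ X (SymForms n) ℝ).flip (innerProd e))

theorem inner_recover (e : X) (p : SymForms n →L[ℝ] ℝ) (y : X) :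
    inner ℝ (recover e p) y = -p (innerProd e y) := by
  simp [recover, inner_neg_left]

theorem recover_evalPair (e x y : X) : recover e (evalPair x y) =
    -((2⁻¹ : ℝ) • (inner ℝ e x • y + inner ℝ e y • x)) := by
  refine ext_inner_right ℝ fun v => ?_
  rw [inner_recover]
  simp only [evalPair_apply, toForm_innerProd, inner_neg_left, inner_smul_left, inner_add_left]
  simp
  rw [real_inner_comm y v, real_inner_comm x v]

/-- Every linear form is of the form `A(x, ·)` with `A` symmetric, if `x ≠ 0`. -/
theorem exists_toForm_eq {x : X} (hx : x ≠ 0) (ξ : X →L[ℝ] ℝ) :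
    ∃ A : SymForms n, toForm A x = ξ := by
  let b : X := (InnerProductSpace.toDual ℝ X).symm ξ
  have hb : ∀ y, inner ℝ b y = ξ y := fun y => by simp [b]
  have hx' : inner ℝ x x ≠ (0 : ℝ) := inner_self_ne_zero.2 hx
  refine ⟨(2 * (inner ℝ x x)⁻¹ : ℝ) • innerProd x b -
    ((inner ℝ x x)⁻¹ ^ 2 * ξ x) • innerProd x x, ?_⟩
  ext y
  simp only [map_sub, map_smul, sub_apply, smul_apply,
    toForm_innerProd, hb, smul_eq_mul]
  field_simp
  ring

/-- A functional on symmetric forms that vanishes on the forms with `x` in their kernel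
is of the form `x ⊙ k`. -/
theorem exists_evalPair_eq {x : X} (hx : x ≠ 0) (q : SymForms n →L[ℝ] ℝ)
    (hq : ∀ H : SymForms n, toForm H x = 0 → q H = 0) : ∃ k, q = evalPair x k := by
  have hx' : inner ℝ x x ≠ (0 : ℝ) := inner_self_ne_zero.2 hx
  -- `A ↦ A(x, ·)` has a linear section, so `q` factors through it
  let T : SymForms n →ₗ[ℝ] X →L[ℝ] ℝ :=
    (ContinuousLinearMap.apply ℝ (X →L[ℝ] ℝ) x ∘L toForm).toLinearMap
  obtain ⟨s, hs⟩ := T.exists_rightInverse_of_surjective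
    (LinearMap.range_eq_top.2 fun ξ => exists_toForm_eq hx ξ)
  let ℓ : X →L[ℝ] ℝ := LinearMap.toContinuousLinearMap
    (q.toLinearMap ∘ₗ s ∘ₗ (innerSL ℝ : X →L[ℝ] X →L[ℝ] ℝ).toLinearMap)
  refine ⟨(InnerProductSpace.toDual ℝ X).symm ℓ, ?_⟩
  ext H
  let h : X := (InnerProductSpace.toDual ℝ X).symm (toForm H x)
  have hh : innerSL ℝ h = toForm H x := by
    ext y; simp [h]
  have h1 : T (H - s (toForm H x)) = 0 := by
    rw [map_sub, show T (s (toForm H x)) = toForm H x from LinearMap.congr_fun hs _]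
    exact sub_self _
  have h2 := hq (H - s (toForm H x)) h1
  rw [map_sub, sub_eq_zero] at h2
  rw [h2, evalPair_apply, ← hh]
  change ℓ h = inner ℝ h _
  rw [real_inner_comm]
  simp

/-! ### The conormal cone in linear coordinates -/

/-- In the coordinates of a frame in which `L₀` becomes `W`: the set of the pairs `(A, -x ⊙ x)`
such that the point over `x` of the graph of `A` lies in `W`. The vector `x` may vanish. -/
def conormalCone (W : Submodule ℝ (X × (X →L[ℝ] ℝ))) :
    Set (SymForms n × (SymForms n →L[ℝ] ℝ)) :=
  {z | ∃ x, (x, toForm z.1 x) ∈ W ∧ z.2 = -evalQuad x}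

/-- The form `A` is the inner product. -/
theorem exists_evalQuad_eq_norm_sq : ∃ A : SymForms n, ∀ x, evalQuad x A = ‖x‖ ^ 2 :=
  ⟨SymForms.mk (innerSL ℝ) fun x y => real_inner_comm y x, fun x => real_inner_self_eq_norm_sq x⟩

theorem evalQuad_ne_zero {x : X} (hx : x ≠ 0) : evalQuad x ≠ 0 := by
  obtain ⟨A, hA⟩ := exists_evalQuad_eq_norm_sq (n := n)
  intro h
  have h1 := hA x
  rw [h, zero_apply, eq_comm, sq_eq_zero_iff, norm_eq_zero] at h1
  exact hx h1

theorem isClosed_conormalCone (W : Submodule ℝ (X × (X →L[ℝ] ℝ))) :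
    IsClosed (conormalCone W) := by
  refine IsSeqClosed.isClosed ?_
  intro u z hu hz
  choose x hxW hx using hu
  obtain ⟨A, hA⟩ := exists_evalQuad_eq_norm_sq (n := n)
  have h1 : Filter.Tendsto (fun k => (u k).1) Filter.atTop (𝓝 z.1) :=
    (continuous_fst.tendsto z).comp hz
  have h2 : Filter.Tendsto (fun k => (u k).2) Filter.atTop (𝓝 z.2) :=
    (continuous_snd.tendsto z).comp hz
  -- the values at the inner product, `-‖x k‖ ^ 2`, converge, so `x` is bounded
  have h3 : Filter.Tendsto (fun k => ‖x k‖ ^ 2) Filter.atTop (𝓝 (-z.2 A)) := by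
    have h4 : Filter.Tendsto (fun k => -(u k).2 A) Filter.atTop (𝓝 (-z.2 A)) :=
      (((ContinuousLinearMap.apply ℝ ℝ A).continuous.tendsto z.2).comp h2).neg
    refine h4.congr fun k => ?_
    rw [hx k, neg_apply, neg_neg, hA]
  obtain ⟨R, hR⟩ := h3.bddAbove_range
  have hb : ∀ k, x k ∈ Metric.closedBall (0 : X) (Real.sqrt R) := fun k => by
    rw [mem_closedBall_zero_iff]
    exact Real.le_sqrt_of_sq_le (hR ⟨k, rfl⟩)
  obtain ⟨y, -, φ, hφ, hy⟩ := (isCompact_closedBall (0 : X) (Real.sqrt R)).tendsto_subseq hb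
  have h1' := h1.comp hφ.tendsto_atTop
  have h2' := h2.comp hφ.tendsto_atTop
  refine ⟨y, ?_, ?_⟩
  · have hc : IsClosed (W : Set (X × (X →L[ℝ] ℝ))) := W.closed_of_finiteDimensional
    have ht : Filter.Tendsto (fun k => (x (φ k), toForm (u (φ k)).1 (x (φ k)))) Filter.atTop
        (𝓝 (y, toForm z.1 y)) := by
      have hj : Continuous fun v : SymForms n × X => toForm v.1 v.2 :=
        (toForm.continuous.comp continuous_fst).clm_apply continuous_snd
      exact hy.prodMk_nhds ((hj.tendsto (z.1, y)).comp (h1'.prodMk_nhds hy))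
    exact hc.mem_of_tendsto ht (Filter.Eventually.of_forall fun k => hxW (φ k))
  · refine tendsto_nhds_unique h2' ?_
    have hc : Continuous fun x : X => -(evalPair x x : SymForms n →L[ℝ] ℝ) := by fun_prop
    refine ((hc.tendsto y).comp hy).congr fun k => ?_
    exact (hx (φ k)).symm

/-- The tangent space of the conormal cone is its own orthogonal. Isotropy comes from that of `W`.
Conversely, pairing `(K, q)` with the vectors `(H, 0)`, `H x = 0`, gives `q = -2 x ⊙ k`, and then
pairing it with all vectors gives that `(k, K x)` lies in the orthogonal of `W`, which is `W`. -/
theorem isLagrangian_tangent_conormalCone {W : Submodule ℝ (X × (X →L[ℝ] ℝ))}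
    (hW : IsLagrangian (stdForm X) W) {x : X} (hx : x ≠ 0)
    {T : Submodule ℝ (SymForms n × (SymForms n →L[ℝ] ℝ))}
    (hT : ∀ u, u ∈ T ↔ ∃ k, (k, toForm u.1 x) ∈ W ∧ u.2 = -(2 : ℝ) • evalPair x k) :
    IsLagrangian (stdForm (SymForms n)) T := by
  ext u
  rw [LinearMap.BilinForm.mem_orthogonal_iff]
  constructor
  · intro hu
    obtain ⟨k, hk⟩ : ∃ k, u.2 = evalPair x k := by
      refine exists_evalPair_eq hx _ fun H hH => ?_
      have h1 : (H, (0 : SymForms n →L[ℝ] ℝ)) ∈ T :=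
        (hT _).2 ⟨0, by rw [hH]; exact W.zero_mem, by simp⟩
      have h2 := hu _ h1
      rw [stdForm_apply] at h2
      simpa using h2
    refine (hT u).2 ⟨-(2⁻¹ : ℝ) • k, ?_, ?_⟩
    · rw [← hW, LinearMap.BilinForm.mem_orthogonal_iff]
      rintro ⟨h, ξ⟩ hw
      obtain ⟨H, hH⟩ := exists_toForm_eq hx ξ
      have h1 : (H, -(2 : ℝ) • evalPair x h) ∈ T := (hT _).2 ⟨h, by rwa [hH], rfl⟩
      have h2 := hu _ h1
      rw [stdForm_apply, hk] at h2
      rw [stdForm_apply]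
      simp only [evalPair_apply, smul_apply, smul_eq_mul, hH, map_smul] at h2 ⊢
      linarith
    · rw [hk, map_smul, smul_smul]
      norm_num
  · intro hu w hw
    obtain ⟨k, hkW, hk⟩ := (hT u).1 hu
    obtain ⟨h, hhW, hh⟩ := (hT w).1 hw
    rw [← hW, LinearMap.BilinForm.mem_orthogonal_iff] at hkW
    have h1 := hkW _ hhW
    rw [stdForm_apply] at h1 ⊢
    rw [hh, hk]
    simp only [evalPair_apply, smul_apply, smul_eq_mul] at h1 ⊢
    linarith

/-- Equations of the conormal cone, where `W` is the kernel of `Q`: with `w = recover e p`, the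
equation `⟨w, e⟩ p + w ⊙ w = 0` says, where `⟨w, e⟩ > 0`, that `p = -x ⊙ x` for a multiple `x` of
`w`; then `(w, A w) ∈ W` amounts to `(x, A x) ∈ W`. -/
def coneEquations (Q : X × (X →L[ℝ] ℝ) →L[ℝ] X × (X →L[ℝ] ℝ)) (e : X)
    (z : SymForms n × (SymForms n →L[ℝ] ℝ)) :
    (X × (X →L[ℝ] ℝ)) × (SymForms n →L[ℝ] ℝ) :=
  (Q (recover e z.2, toForm z.1 (recover e z.2)),
    (inner ℝ (recover e z.2) e : ℝ) • z.2 + evalPair (recover e z.2) (recover e z.2))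

theorem contDiff_coneEquations (Q : X × (X →L[ℝ] ℝ) →L[ℝ] X × (X →L[ℝ] ℝ)) (e : X) :
    ContDiff ℝ ∞ (coneEquations Q e) := by
  unfold coneEquations
  have h1 : ContDiff ℝ ∞ fun z : SymForms n × (SymForms n →L[ℝ] ℝ) => recover e z.2 :=
    (recover e).contDiff.comp contDiff_snd
  have h2 : ContDiff ℝ ∞ fun z : SymForms n × (SymForms n →L[ℝ] ℝ) => toForm z.1 :=
    toForm.contDiff.comp contDiff_fst
  exact (Q.contDiff.comp (h1.prodMk (h2.clm_apply h1))).prodMk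
    (((h1.inner ℝ contDiff_const).smul contDiff_snd).add
      ((evalPair.contDiff.comp h1).clm_apply h1))

/-- The derivative of `coneEquations Q e` at `(0, -x ⊙ x)`, if `⟨x, e⟩ = 1`. -/
def coneDeriv (Q : X × (X →L[ℝ] ℝ) →L[ℝ] X × (X →L[ℝ] ℝ)) (e x : X) :
    SymForms n × (SymForms n →L[ℝ] ℝ) →L[ℝ] (X × (X →L[ℝ] ℝ)) × (SymForms n →L[ℝ] ℝ) :=
  let w := recover e ∘L ContinuousLinearMap.snd ℝ (SymForms n) (SymForms n →L[ℝ] ℝ)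
  (Q ∘L w.prod (toForm.flip x ∘L ContinuousLinearMap.fst ℝ _ _)).prod
    (ContinuousLinearMap.snd ℝ _ _ - ((innerSL ℝ e) ∘L w).smulRight (evalPair x x) +
      (2 : ℝ) • (evalPair x ∘L w))

theorem evalPair_comm (x y : X) : (evalPair x y : SymForms n →L[ℝ] ℝ) = evalPair y x := by
  ext A
  exact toForm_symm A x y

theorem coneDeriv_apply (Q : X × (X →L[ℝ] ℝ) →L[ℝ] X × (X →L[ℝ] ℝ)) (e x : X)
    (u : SymForms n × (SymForms n →L[ℝ] ℝ)) :
    coneDeriv Q e x u = (Q (recover e u.2, toForm u.1 x),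
      u.2 - (inner ℝ e (recover e u.2) : ℝ) • evalPair x x +
        (2 : ℝ) • evalPair x (recover e u.2)) := rfl

theorem recover_neg_evalQuad {e x : X} (hex : inner ℝ e x = (1 : ℝ)) :
    recover e (-evalQuad x) = x := by
  rw [← evalPair_self, map_neg, recover_evalPair, hex, neg_neg, one_smul, smul_add, ← add_smul]
  norm_num

theorem hasFDerivAt_coneEquations (Q : X × (X →L[ℝ] ℝ) →L[ℝ] X × (X →L[ℝ] ℝ)) {e x : X}
    (hex : inner ℝ e x = (1 : ℝ)) :
    HasFDerivAt (coneEquations Q e) (coneDeriv Q e x) (0, -evalQuad x) := by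
  let a : SymForms n × (SymForms n →L[ℝ] ℝ) := (0, -evalQuad x)
  have ha : recover e a.2 = x := recover_neg_evalQuad hex
  have h1 : HasFDerivAt (fun z : SymForms n × (SymForms n →L[ℝ] ℝ) => recover e z.2) _ a :=
    (recover e).hasFDerivAt.comp a hasFDerivAt_snd
  have h2 : HasFDerivAt (fun z : SymForms n × (SymForms n →L[ℝ] ℝ) => toForm z.1) _ a :=
    toForm.hasFDerivAt.comp a hasFDerivAt_fst
  have h3 := (Q.hasFDerivAt.comp a (h1.prodMk (h2.clm_apply h1))).prodMk
    (((h1.inner ℝ (hasFDerivAt_const e a)).smul hasFDerivAt_snd).add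
      ((evalPair.hasFDerivAt.comp a h1).clm_apply h1))
  refine h3.congr_fderiv ?_
  refine ContinuousLinearMap.ext fun u => ?_
  rw [coneDeriv_apply]
  refine Prod.ext ?_ ?_
  · simp [ha, a]
  · have hxe : inner ℝ x e = (1 : ℝ) := by rw [real_inner_comm, hex]
    simp [ha, a, hxe]
    rw [evalPair_comm (recover e u.2) x, real_inner_comm e, evalPair_self]
    module

/-- The image of the derivative contains all values of the equations: its elements `(Q (h, ξ), ρ)`
are subject only to the constraint `recover e ρ = 0`, which the second component
`⟨w, e⟩ p + w ⊙ w` of the equations satisfies. -/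
theorem coneEquations_mem_range (Q : X × (X →L[ℝ] ℝ) →L[ℝ] X × (X →L[ℝ] ℝ)) {e x : X}
    (hex : inner ℝ e x = (1 : ℝ)) (z : SymForms n × (SymForms n →L[ℝ] ℝ)) :
    coneEquations Q e z ∈ LinearMap.range (coneDeriv Q e x).toLinearMap := by
  have hx : x ≠ 0 := by rintro rfl; simp at hex
  let h : X := recover e z.2
  obtain ⟨H, hH⟩ := exists_toForm_eq hx (toForm z.1 h)
  let ρ : SymForms n →L[ℝ] ℝ := (inner ℝ h e : ℝ) • z.2 + evalPair h h
  have hρ : recover e ρ = 0 := by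
    simp only [ρ, map_add, map_smul, recover_evalPair]
    rw [real_inner_comm]
    simp only [h]
    module
  -- the solution `q` of `recover e q = h` for which the second component of the derivative is `ρ`
  let q : SymForms n →L[ℝ] ℝ :=
    ρ - (2 : ℝ) • evalPair x h + (inner ℝ e h : ℝ) • evalPair x x
  have hq : recover e q = h := by
    simp only [q, map_add, map_sub, map_smul, recover_evalPair, hρ, hex]
    module
  refine ⟨(H, q), ?_⟩
  change coneDeriv Q e x (H, q) = _
  rw [coneDeriv_apply]
  refine Prod.ext ?_ ?_
  · simp only [hq, hH]; rfl
  · simp only [hq]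
    change q - _ + _ = ρ
    simp only [q]
    module

/-- The tangent space of the conormal cone at `(0, -x ⊙ x)`. An element `(H, q)` of the kernel is of
the stated form for `k = h - ⟨e, h⟩ x / 2`, where `h = recover e q`; as `(x, 0)` lies in `W`, the
condition that `(h, H x)` lies in `W` may be expressed with `k` instead. -/
theorem mem_ker_coneDeriv {W : Submodule ℝ (X × (X →L[ℝ] ℝ))}
    {Q : X × (X →L[ℝ] ℝ) →L[ℝ] X × (X →L[ℝ] ℝ)} (hQ : ∀ v, Q v = 0 ↔ v ∈ W) {e x : X}
    (hex : inner ℝ e x = (1 : ℝ)) (hx : (x, 0) ∈ W) (u : SymForms n × (SymForms n →L[ℝ] ℝ)) :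
    u ∈ LinearMap.ker (coneDeriv Q e x).toLinearMap ↔
      ∃ k, (k, toForm u.1 x) ∈ W ∧ u.2 = -(2 : ℝ) • evalPair x k := by
  change coneDeriv Q e x u = 0 ↔ _
  rw [coneDeriv_apply, Prod.mk_eq_zero, hQ]
  constructor
  · rintro ⟨h1, h2⟩
    set h := recover e u.2
    refine ⟨h - (2⁻¹ * inner ℝ e h : ℝ) • x, ?_, ?_⟩
    · have := W.sub_mem h1 (W.smul_mem (2⁻¹ * inner ℝ e h : ℝ) hx)
      simpa using this
    · rw [map_sub, map_smul]
      have h3 : u.2 = (inner ℝ e h : ℝ) • evalPair x x - (2 : ℝ) • evalPair x h := by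
        rw [← sub_eq_zero, ← h2]; abel
      rw [h3]
      module
  · rintro ⟨k, hk, hu⟩
    have h1 : recover e u.2 = k + (inner ℝ e k : ℝ) • x := by
      rw [hu, map_smul, recover_evalPair, hex]
      module
    rw [h1]
    constructor
    · have := W.add_mem hk (W.smul_mem (inner ℝ e k : ℝ) hx)
      simpa using this
    · rw [hu, inner_add_right, inner_smul_right, hex, map_add, map_smul]
      module

/-- Where `⟨w, e⟩ > 0`, the equations define the conormal cone: a solution `p = -⟨w, e⟩⁻¹ w ⊙ w`
is `-x ⊙ x` for `x = w / √⟨w, e⟩`. -/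
theorem coneEquations_eq_zero_iff {W : Submodule ℝ (X × (X →L[ℝ] ℝ))}
    {Q : X × (X →L[ℝ] ℝ) →L[ℝ] X × (X →L[ℝ] ℝ)} (hQ : ∀ v, Q v = 0 ↔ v ∈ W) {e : X}
    {z : SymForms n × (SymForms n →L[ℝ] ℝ)} (hz : 0 < (inner ℝ (recover e z.2) e : ℝ)) :
    coneEquations Q e z = 0 ↔ z ∈ conormalCone W := by
  rw [coneEquations, Prod.mk_eq_zero, hQ]
  constructor
  · rintro ⟨h1, h2⟩
    set w := recover e z.2
    set c : ℝ := inner ℝ w e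
    have hc : (Real.sqrt c)⁻¹ * (Real.sqrt c)⁻¹ = c⁻¹ := by
      rw [← mul_inv, Real.mul_self_sqrt hz.le]
    refine ⟨(Real.sqrt c)⁻¹ • w, ?_, ?_⟩
    · simpa using W.smul_mem (Real.sqrt c)⁻¹ h1
    · rw [← evalPair_self, map_smul, map_smul, smul_apply, smul_smul, hc,
        eq_neg_of_add_eq_zero_right h2, smul_neg, neg_neg, smul_smul, inv_mul_cancel₀ hz.ne',
        one_smul]
  · rintro ⟨x, hx, hz2⟩
    have h1 : recover e z.2 = (inner ℝ e x : ℝ) • x := by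
      rw [hz2, ← evalPair_self, map_neg, recover_evalPair]
      module
    rw [h1]
    constructor
    · simpa using W.smul_mem (inner ℝ e x : ℝ) hx
    · rw [hz2, ← evalPair_self]
      simp only [map_smul, smul_apply, real_inner_smul_left]
      rw [real_inner_comm e x]
      module

/-- Around `(0, -x ⊙ x)`, with `x ≠ 0`, the conormal cone of a lagrangian subspace is straightened
by a local diffeomorphism tangent to the identity, onto a lagrangian subspace. -/
theorem exists_straightening_conormalCone {W : Submodule ℝ (X × (X →L[ℝ] ℝ))}
    (hW : IsLagrangian (stdForm X) W) {x : X} (hx : x ≠ 0) (hxW : (x, 0) ∈ W) :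
    ∃ (Φ : OpenPartialHomeomorph (SymForms n × (SymForms n →L[ℝ] ℝ))
        (SymForms n × (SymForms n →L[ℝ] ℝ)))
      (F : Submodule ℝ (SymForms n × (SymForms n →L[ℝ] ℝ))),
      (0, -evalQuad x) ∈ Φ.source ∧ (∀ z ∈ Φ.source, z.2 ≠ 0) ∧
      ContDiffOn ℝ ∞ Φ Φ.source ∧ ContDiffOn ℝ ∞ Φ.symm Φ.target ∧
      HasFDerivAt Φ (ContinuousLinearMap.id ℝ _) (0, -evalQuad x) ∧
      (∀ z ∈ Φ.source, z ∈ conormalCone W ↔ Φ z ∈ F) ∧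
      IsLagrangian (stdForm (SymForms n)) F := by
  obtain ⟨Q, hQ⟩ : ∃ Q : X × (X →L[ℝ] ℝ) →L[ℝ] X × (X →L[ℝ] ℝ), ∀ v, Q v = 0 ↔ v ∈ W := by
    -- the projection onto a complement of `W`
    obtain ⟨W', hW'⟩ := W.exists_isCompl
    refine ⟨LinearMap.toContinuousLinearMap
      (W'.subtype ∘ₗ W'.projectionOnto W hW'.symm), fun v => ?_⟩
    rw [LinearMap.coe_toContinuousLinearMap', LinearMap.comp_apply, Submodule.subtype_apply,
      Submodule.coe_eq_zero]
    exact Submodule.projectionOnto_apply_eq_zero_iff hW'.symm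
  -- the normalization `⟨e, x⟩ = 1`
  let e : X := (inner ℝ x x : ℝ)⁻¹ • x
  have hex : inner ℝ e x = (1 : ℝ) := by
    rw [real_inner_smul_left, inv_mul_cancel₀ (inner_self_ne_zero.2 hx)]
  let U : Set (SymForms n × (SymForms n →L[ℝ] ℝ)) := {z | 0 < (inner ℝ (recover e z.2) e : ℝ)}
  have hU : IsOpen U := by
    refine isOpen_lt continuous_const ?_
    exact ((recover e).continuous.comp continuous_snd).inner continuous_const
  have haU : ((0 : SymForms n), -evalQuad x) ∈ U := by
    change 0 < (inner ℝ (recover e (-evalQuad x)) e : ℝ)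
    rw [recover_neg_evalQuad hex, real_inner_comm, hex]
    exact one_pos
  obtain ⟨Φ, ha, hΦU, h1, h2, h3, h4⟩ := exists_openPartialHomeomorph_straightening_zeros
    (contDiff_coneEquations Q e) (hasFDerivAt_coneEquations Q hex) (coneEquations_mem_range Q hex)
    hU haU
  -- `p = 0` is excluded on `U`, where `⟨recover e p, e⟩ > 0`
  refine ⟨Φ, _, ha, fun z hz h0 => ?_, h1, h2, h3, fun z hz => ?_,
    isLagrangian_tangent_conormalCone hW hx (mem_ker_coneDeriv hQ hex hxW)⟩
  · have := hΦU hz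
    change 0 < (inner ℝ (recover e z.2) e : ℝ) at this
    simp [h0] at this
  · rw [← coneEquations_eq_zero_iff hQ (hΦU hz)]
    exact h4 z

end SymForms

/-! ### Pullback of lagrangian subspaces and changes of charts -/

/-- The pullback of a lagrangian subspace under a surjective linear map is lagrangian for the
pulled back form. -/
theorem isLagrangian_comap {V W : Type*} [AddCommGroup V] [Module ℝ V] [AddCommGroup W]
    [Module ℝ W] {B : LinearMap.BilinForm ℝ W} {F : Submodule ℝ W} (hF : IsLagrangian B F)
    (f : V →ₗ[ℝ] W) (hf : Function.Surjective f) : IsLagrangian (B.comp f f) (F.comap f) := by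
  ext u
  rw [LinearMap.BilinForm.mem_orthogonal_iff, Submodule.mem_comap]
  conv_rhs => rw [← hF]
  rw [LinearMap.BilinForm.mem_orthogonal_iff]
  constructor
  · intro h w hw
    obtain ⟨v, rfl⟩ := hf w
    exact h v hw
  · intro h v hv
    exact h _ hv

/-- A chart composed with a smooth local diffeomorphism of the model space is a chart.
The type `ModelProd E F` of the values of the charts is a copy of `E × F`. -/
theorem trans_mem_maximalAtlas_of_contDiffOn {E F : Type*} [NormedAddCommGroup E] [NormedSpace ℝ E]
    [NormedAddCommGroup F] [NormedSpace ℝ F] {P : Type*} [TopologicalSpace P]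
    [ChartedSpace (ModelProd E F) P] [IsManifold (𝓘(ℝ, E).prod 𝓘(ℝ, F)) ∞ P]
    {e : OpenPartialHomeomorph P (ModelProd E F)}
    (he : e ∈ IsManifold.maximalAtlas (𝓘(ℝ, E).prod 𝓘(ℝ, F)) ∞ P)
    {Φ : OpenPartialHomeomorph (E × F) (E × F)}
    (h1 : ContDiffOn ℝ ∞ Φ Φ.source) (h2 : ContDiffOn ℝ ∞ Φ.symm Φ.target) :
    e ≫ₕ (Φ : OpenPartialHomeomorph (ModelProd E F) (ModelProd E F)) ∈
      IsManifold.maximalAtlas (𝓘(ℝ, E).prod 𝓘(ℝ, F)) ∞ P := by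
  have hΦ : (Φ : OpenPartialHomeomorph (ModelProd E F) (ModelProd E F)) ∈
      contDiffGroupoid ∞ (𝓘(ℝ, E).prod 𝓘(ℝ, F)) := by
    refine mem_groupoid_of_pregroupoid.2 ?_
    exact ⟨h1.mono fun z hz => hz.1, h2.mono fun z hz => hz.1⟩
  intro e' he'
  have he'' := IsManifold.subset_maximalAtlas (I := 𝓘(ℝ, E).prod 𝓘(ℝ, F)) (n := ∞) he'
  constructor
  · rw [OpenPartialHomeomorph.trans_symm_eq_symm_trans_symm, OpenPartialHomeomorph.trans_assoc]
    exact StructureGroupoid.trans _ (StructureGroupoid.symm _ hΦ)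
      (StructureGroupoid.compatible_of_mem_maximalAtlas he he'')
  · rw [← OpenPartialHomeomorph.trans_assoc]
    exact StructureGroupoid.trans _ (StructureGroupoid.compatible_of_mem_maximalAtlas he'' he) hΦ

/-! ### Changes of frames -/

section Grassmannian

variable {V : Type*} [AddCommGroup V] [Module ℝ V] {σ : SymplecticForm V}

local notation "SE" => SymForms (halfDim V)

namespace Frame

/-- The derivative `D` at `A` of the change of charts carries the quadratic functional `y ⊙ y` to
`x ⊙ x`, where `y` and `x` are the base components, in the frames `φ'` and `φ`, of the same vector
of the graph of `A`. Both `H(x, x)` and `(D H)(y, y)` are the symplectic form evaluated at that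
vector and at the velocity of the point over `x` when `A` moves with velocity `H`. -/
theorem evalQuad_comp_fderiv_trans (φ φ' : Frame σ) {A : SE}
    (hA : A ∈ (φ.chart.symm.trans φ'.chart).source)
    {D : SE →L[ℝ] SE}
    (hD : HasFDerivAt (φ'.chart ∘ φ.chart.symm) D A) (x : QSpace V) :
    evalQuad (transBase φ φ' (SymForms.toForm A) x) ∘L D = evalQuad x := by
  let f : SE → SE := φ'.chart ∘ φ.chart.symm
  let ev : SE →L[ℝ] QSpace V →L[ℝ] ℝ := SymForms.toForm.flip x
  -- the point over `x` of the graph of `A'`, seen in the frame `φ'`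
  let P : SE → QSpace V × (QSpace V →L[ℝ] ℝ) :=
    fun A' => change φ φ' (x, SymForms.toForm A' x)
  have hP : HasFDerivAt P (change φ φ' ∘L
      (0 : SE →L[ℝ] QSpace V).prod ev) A :=
    (change φ φ').hasFDerivAt.comp A ((hasFDerivAt_const x A).prodMk ev.hasFDerivAt)
  have hb : ∀ A', (P A').1 = transBase φ φ' (SymForms.toForm A') x := fun A' =>
    (transBase_apply φ φ' _ x).symm
  have hc : ∀ A', (P A').2 = transFibre φ φ' (SymForms.toForm A') x := fun A' =>
    (transFibre_apply φ φ' _ x).symm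
  have heq : ∀ A' ∈ (φ.chart.symm.trans φ'.chart).source,
      (P A').2 = SymForms.toForm (f A') (P A').1 := by
    intro A' hA'
    have h1 : φ.graph A' = φ'.graph (f A') :=
      (φ'.chart.left_inv (PartialEquiv.trans_source _ _ ▸ hA').2).symm
    rw [hb, hc, transFibre_eq φ φ' h1, ContinuousLinearMap.comp_apply]
  have hev : (fun A' => (P A').2) =ᶠ[𝓝 A] fun A' => SymForms.toForm (f A') (P A').1 :=
    Filter.eventuallyEq_of_mem ((isOpen_trans_source φ φ').mem_nhds hA) heq
  have h1 := (((SymForms.toForm (n := halfDim V)).hasFDerivAt.comp A hD).clm_apply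
    (hasFDerivAt_fst.comp A hP)).congr_of_eventuallyEq hev
  have h2 := h1.unique (hasFDerivAt_snd.comp A hP)
  refine ContinuousLinearMap.ext fun H => ?_
  have h3 := congrArg (fun T => T H (P A).1) h2
  -- the velocity of `P`, in the frame `φ'`
  let w : QSpace V × (QSpace V →L[ℝ] ℝ) := change φ φ' (0, SymForms.toForm H x)
  have h4 : SymForms.toForm (f A) w.1 (P A).1 + SymForms.toForm (D H) (P A).1 (P A).1 =
      w.2 (P A).1 := h3
  rw [SymForms.toForm_symm, ← heq A hA] at h4
  have h5 : stdForm (QSpace V) (P A) w = SymForms.toForm H x x := by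
    change stdForm (QSpace V) (φ'.toEquiv (φ.toEquiv.symm _)) (φ'.toEquiv (φ.toEquiv.symm _)) = _
    rw [φ'.symplectic, ← φ.symplectic]
    simp
  rw [stdForm_apply] at h5
  rw [ContinuousLinearMap.comp_apply, ← hb, SymForms.evalQuad_apply, SymForms.evalQuad_apply]
  linarith

/-- The image of a lagrangian subspace of `V` under a frame is lagrangian. -/
theorem isLagrangian_comap_symm (φ : Frame σ) (L : LagrangianGrassmannian σ) :
    IsLagrangian (stdForm (QSpace V)) (L.carrier.comap φ.toEquiv.symm.toLinearMap) := by
  ext u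
  have h := L.isLagrangian
  rw [IsLagrangian] at h
  rw [Submodule.mem_comap, LinearEquiv.coe_coe]
  conv_rhs => rw [← h]
  rw [LinearMap.BilinForm.mem_orthogonal_iff, LinearMap.BilinForm.mem_orthogonal_iff]
  constructor
  · intro hu w hw
    rw [← φ.symplectic, LinearEquiv.apply_symm_apply]
    exact hu _ (by simpa using hw)
  · intro hu w hw
    have := hu _ hw
    rwa [← φ.symplectic, LinearEquiv.coe_coe, LinearEquiv.apply_symm_apply,
      LinearEquiv.apply_symm_apply] at this

end Frame

/-! ### The covectors `v ⊙ v` -/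

variable [FiniteDimensional ℝ V]

/-- The tangent space at `L` is by definition the model space seen through the preferred chart
at `L`, which is that of `frameAt L`. -/
theorem tangentToForm_eq_id (L : LagrangianGrassmannian σ) :
    tangentToForm L = ContinuousLinearMap.id ℝ SE :=
  mfderiv_extChartAt_self (I := 𝓘(ℝ, SE)) (x := L)

theorem symSquare_eq (L : LagrangianGrassmannian σ) (v : V) :
    symSquare L v = evalQuad ((frameAt L).toEquiv v).1 := by
  rw [symSquare, tangentToForm_eq_id]
  rfl

theorem frameAt_snd_eq_zero {L : LagrangianGrassmannian σ} {v : V} (hv : v ∈ L.carrier) :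
    ((frameAt L).toEquiv v).2 = 0 := by
  have h : v ∈ ((frameAt L).graph 0).carrier := by rwa [graph_frameAt]
  rw [Frame.mem_graph] at h
  rw [h, map_zero, zero_apply]

theorem symSquare_ne_zero {L : LagrangianGrassmannian σ} {v : V} (hv : v ∈ L.carrier)
    (h0 : v ≠ 0) : symSquare L v ≠ 0 := by
  rw [symSquare_eq]
  refine SymForms.evalQuad_ne_zero fun h => h0 ?_
  rw [← (frameAt L).toEquiv.map_eq_zero_iff]
  exact Prod.ext h (frameAt_snd_eq_zero hv)

theorem symSquare_smul (L : LagrangianGrassmannian σ) (c : ℝ) (v : V) :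
    symSquare L (c • v) = c ^ 2 • symSquare L v := by
  rw [symSquare_eq, symSquare_eq, map_smul, Prod.smul_fst, ← SymForms.evalPair_self,
    ← SymForms.evalPair_self, map_smul, map_smul, smul_apply, smul_smul, sq]
  rfl

theorem symSquare_zero (L : LagrangianGrassmannian σ) : symSquare L (0 : V) = 0 := by
  simpa using symSquare_smul L 0 (0 : V)

/-! ### Canonical coordinates on the cotangent bundle -/

/-- The fibre coordinate of the covector `ξ` at `M` in the chart of `T*Λ` at a point over `L`. -/
def covectorCoord (L M : LagrangianGrassmannian σ) (ξ : CotangentSpace SE M) :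
    SE →L[ℝ] ℝ :=
  ξ ∘L (tangentCoordChange 𝓘(ℝ, SE) L M M)

theorem chartAt_cotangentBundle_apply
    (z q : CotangentBundle SE (LagrangianGrassmannian σ))
    (hq : q.1 ∈ (frameAt z.1).chart.source) :
    chartAt (ModelProd SE (SE →L[ℝ] ℝ)) z q =
      ((frameAt z.1).chart q.1, covectorCoord z.1 q.1 q.2) := by
  rw [hom_chart]
  refine Prod.ext rfl ?_
  change ContinuousLinearMap.comp _ (q.2 ∘L _) = covectorCoord _ _ _
  rw [TangentBundle.symmL_trivializationAt_eq_core hq]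
  ext H
  simp [covectorCoord]

theorem mem_chartAt_cotangentBundle_source
    (z q : CotangentBundle SE (LagrangianGrassmannian σ)) :
    q ∈ (chartAt (ModelProd SE (SE →L[ℝ] ℝ)) z).source ↔
      q.1 ∈ (frameAt z.1).chart.source := by
  simp only [FiberBundle.chartedSpace_chartAt, mfld_simps]
  exact ⟨fun h => h.1.1, fun h => ⟨⟨h, trivial⟩, h⟩⟩

/-- In the chart at `L`, the covector `v ⊙ v` at `M` is `x ⊙ x`, where `x` is the base component
of `v` in the frame at `L`. -/
theorem covectorCoord_symSquare {L M : LagrangianGrassmannian σ}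
    (hM : M ∈ (frameAt L).chart.source) {v : V} (hv : v ∈ M.carrier) :
    covectorCoord L M (symSquare M v) = evalQuad ((frameAt L).toEquiv v).1 := by
  rw [symSquare_eq]
  let φ := frameAt L
  let φ' := frameAt M
  let A := φ.chart M
  have hgA : φ.graph A = M := φ.chart.left_inv hM
  have hM' : M ∈ φ'.chart.source := mem_chart_source SE M
  have hA : A ∈ (φ.chart.symm.trans φ'.chart).source := by
    rw [PartialEquiv.trans_source]
    refine ⟨trivial, ?_⟩
    change φ.graph A ∈ φ'.chart.source
    rwa [hgA]
  have hD : HasFDerivAt (φ'.chart ∘ φ.chart.symm)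
      (tangentCoordChange 𝓘(ℝ, SE) L M M) A := by
    have h := hasFDerivWithinAt_tangentCoordChange (I := 𝓘(ℝ, SE))
      (x := L) (y := M) (z := M) (by simpa only [extChartAt_source] using ⟨hM, hM'⟩)
    rw [modelWithCornersSelf_coe, Set.range_id, hasFDerivWithinAt_univ] at h
    exact h
  have hv' : (φ.toEquiv v).2 = SymForms.toForm A (φ.toEquiv v).1 := by
    rw [← Frame.mem_graph, hgA]
    exact hv
  have h1 := φ.evalQuad_comp_fderiv_trans φ' hA hD (φ.toEquiv v).1
  rw [Frame.transBase_apply, ← hv', Prod.mk.eta, LinearEquiv.symm_apply_apply] at h1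
  exact h1

theorem covectorCoord_injective {L M : LagrangianGrassmannian σ}
    (hM : M ∈ (frameAt L).chart.source) : Function.Injective (covectorCoord L M) := by
  intro ξ η h
  have hM' : M ∈ (chartAt SE M).source := mem_chart_source _ M
  have h2 : ∀ H, tangentCoordChange 𝓘(ℝ, SE) L M M
      (tangentCoordChange 𝓘(ℝ, SE) M L M H) = H := by
    intro H
    refine (tangentCoordChange_comp ?_).trans (tangentCoordChange_self ?_)
    · simp only [extChartAt_source]
      exact ⟨⟨hM', hM⟩, hM'⟩
    · rwa [extChartAt_source]
  have h3 : ∀ (ζ : CotangentSpace SE M) (H : SE),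
      covectorCoord L M ζ (tangentCoordChange 𝓘(ℝ, SE) M L M H) = ζ H :=
    fun ζ H => congrArg ζ (h2 H)
  refine ContinuousLinearMap.ext fun H => ?_
  exact (h3 ξ H).symm.trans ((by rw [h] : _ = _).trans (h3 η H))

/-! ### The lift of the Maslov cycle -/

/-- The union of `maslovLift L₀` and the zero section: the vector `v` may vanish. -/
def closedMaslovLift (L₀ : LagrangianGrassmannian σ) :
    Set (CotangentBundle SE (LagrangianGrassmannian σ)) :=
  {z | ∃ v ∈ z.1.carrier ⊓ L₀.carrier, z.2 = -symSquare z.1 v}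

theorem mem_maslovLift_iff {L₀ : LagrangianGrassmannian σ}
    {z : CotangentBundle SE (LagrangianGrassmannian σ)} :
    z ∈ maslovLift L₀ ↔ z ∈ closedMaslovLift L₀ ∧ z.2 ≠ 0 := by
  constructor
  · rintro ⟨v, hv, h0, hz⟩
    refine ⟨⟨v, hv, hz⟩, ?_⟩
    rw [hz]
    exact neg_ne_zero.2 (symSquare_ne_zero hv.1 h0)
  · rintro ⟨⟨v, hv, hz⟩, h0⟩
    refine ⟨v, hv, ?_, hz⟩
    rintro rfl
    rw [symSquare_zero, neg_zero] at hz
    exact h0 hz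

theorem covectorCoord_neg (L M : LagrangianGrassmannian σ)
    (ξ : CotangentSpace SE M) :
    covectorCoord L M (-ξ) = -covectorCoord L M ξ := rfl

theorem covectorCoord_zero (L M : LagrangianGrassmannian σ) : covectorCoord L M 0 = 0 :=
  ContinuousLinearMap.zero_comp _

/-- The subspace `L₀` in the coordinates of the frame at `L`. -/
def inFrameAt (L L₀ : LagrangianGrassmannian σ) :
    Submodule ℝ (QSpace V × (QSpace V →L[ℝ] ℝ)) :=
  L₀.carrier.comap (frameAt L).toEquiv.symm.toLinearMap

/-- In the canonical coordinates at `z`, the set `closedMaslovLift L₀` is a conormal cone. -/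
theorem mem_closedMaslovLift_iff (L₀ : LagrangianGrassmannian σ)
    {z q : CotangentBundle SE (LagrangianGrassmannian σ)}
    (hq : q ∈ (chartAt (ModelProd SE (SE →L[ℝ] ℝ)) z).source) :
    q ∈ closedMaslovLift L₀ ↔ chartAt (ModelProd SE (SE →L[ℝ] ℝ)) z q ∈
      SymForms.conormalCone (inFrameAt z.1 L₀) := by
  rw [mem_chartAt_cotangentBundle_source] at hq
  rw [chartAt_cotangentBundle_apply z q hq]
  let φ := frameAt z.1
  have hg : φ.graph (φ.chart q.1) = q.1 := φ.chart.left_inv hq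
  have hmem : ∀ v, v ∈ q.1.carrier ↔ (φ.toEquiv v).2 =
      SymForms.toForm (φ.chart q.1) (φ.toEquiv v).1 := fun v => by
    rw [← Frame.mem_graph, hg]
  constructor
  · rintro ⟨v, hv, hz⟩
    refine ⟨(φ.toEquiv v).1, ?_, ?_⟩
    · change φ.toEquiv.symm (_, _) ∈ L₀.carrier
      rw [← (hmem v).1 hv.1, Prod.mk.eta, LinearEquiv.symm_apply_apply]
      exact hv.2
    · change covectorCoord z.1 q.1 q.2 = _
      rw [hz, covectorCoord_neg, covectorCoord_symSquare hq hv.1]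
  · rintro ⟨x, hx, hp⟩
    let v := φ.toEquiv.symm (x, SymForms.toForm (φ.chart q.1) x)
    have hv : v ∈ q.1.carrier := (hmem v).2 (by simp [v])
    refine ⟨v, ⟨hv, hx⟩, covectorCoord_injective hq ?_⟩
    rw [covectorCoord_neg, covectorCoord_symSquare hq hv]
    refine Eq.trans hp ?_
    simp [v, φ]

theorem isClosed_closedMaslovLift (L₀ : LagrangianGrassmannian σ) :
    IsClosed (closedMaslovLift L₀) := by
  rw [← isOpen_compl_iff, isOpen_iff_forall_mem_open]
  intro z hz
  let e := chartAt (ModelProd SE (SE →L[ℝ] ℝ)) z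
  refine ⟨e.source ∩ e ⁻¹' (SymForms.conormalCone (inFrameAt z.1 L₀))ᶜ, fun q hq h => ?_,
    e.isOpen_inter_preimage (SymForms.isClosed_conormalCone _).isOpen_compl,
    mem_chart_source _ z, fun h => hz ?_⟩
  · exact hq.2 ((mem_closedMaslovLift_iff L₀ hq.1).1 h)
  · exact (mem_closedMaslovLift_iff L₀ (mem_chart_source _ z)).2 h

theorem frameAt_chart_self (L : LagrangianGrassmannian σ) : (frameAt L).chart L = 0 := by
  have h := (frameAt L).chart.right_inv (x := 0) trivial
  change (frameAt L).chart ((frameAt L).graph 0) = 0 at h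
  rwa [graph_frameAt] at h

/-- The slice chart at `z` is the canonical chart at `z` followed by the diffeomorphism `Φ` that
straightens the conormal cone. As `Φ` is tangent to the identity, the two charts have the same
derivative at `z`, so the tangent space is the pullback of a lagrangian subspace by the very map
that defines the canonical form. -/
theorem isLagrangianSubmanifold_maslovLift (L₀ : LagrangianGrassmannian σ) :
    IsLagrangianSubmanifold (maslovLift L₀) := by
  intro z hz
  let e := chartAt (ModelProd SE (SE →L[ℝ] ℝ)) z
  have hze : z ∈ e.source := mem_chart_source _ z
  obtain ⟨x, hxW, hx⟩ := (mem_closedMaslovLift_iff L₀ hze).1 (mem_maslovLift_iff.1 hz).1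
  have he0 : (e z).1 = 0 := frameAt_chart_self z.1
  rw [he0, map_zero, zero_apply] at hxW
  have hez : e z = (0, -evalQuad x) := Prod.ext he0 hx
  have hx0 : x ≠ 0 := by
    rintro rfl
    refine (mem_maslovLift_iff.1 hz).2
      (covectorCoord_injective (L := z.1) ((mem_chartAt_cotangentBundle_source z z).1 hze) ?_)
    have h1 : covectorCoord z.1 z.1 z.2 = (e z).2 := by
      rw [chartAt_cotangentBundle_apply z z ((mem_chartAt_cotangentBundle_source z z).1 hze)]
    rw [h1, hez]
    change -evalQuad 0 = 0
    rw [← SymForms.evalPair_self, map_zero, neg_eq_zero]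
  obtain ⟨Φ, F, ha, hne, h1, h2, h3, h4, hF⟩ := SymForms.exists_straightening_conormalCone
    ((frameAt z.1).isLagrangian_comap_symm L₀) hx0 hxW
  let Φ' : OpenPartialHomeomorph (ModelProd SE (SE →L[ℝ] ℝ)) (ModelProd SE (SE →L[ℝ] ℝ)) := Φ
  refine ⟨e ≫ₕ Φ', F, ⟨?_, ?_, ?_⟩, ?_⟩
  · exact trans_mem_maximalAtlas_of_contDiffOn (IsManifold.chart_mem_maximalAtlas z) h1 h2
  · rw [OpenPartialHomeomorph.trans_source]
    refine ⟨hze, ?_⟩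
    change e z ∈ Φ.source
    rwa [hez]
  · intro q hq
    rw [OpenPartialHomeomorph.trans_source] at hq
    rw [mem_maslovLift_iff, mem_closedMaslovLift_iff L₀ hq.1]
    have hq0 : q.2 ≠ 0 := by
      intro h0
      refine hne (e q) hq.2 ?_
      rw [chartAt_cotangentBundle_apply z q ((mem_chartAt_cotangentBundle_source z q).1 hq.1), h0]
      exact covectorCoord_zero _ _
    exact (and_iff_left hq0).trans (h4 (e q) hq.2)
  · have hD : (mfderiv (cotangentModel SE) 𝓘(ℝ, SE × (SE →L[ℝ] ℝ))
        ((e ≫ₕ Φ').extend (cotangentModel SE)) z) =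
        mfderiv (cotangentModel SE) 𝓘(ℝ, SE × (SE →L[ℝ] ℝ))
          (extChartAt (cotangentModel SE) z) z := by
      have h5 : HasFDerivAt Φ (ContinuousLinearMap.id ℝ _)
          (extChartAt (cotangentModel SE) z z) := by
        rw [← hez] at h3
        exact h3
      have h6 := h5.hasMFDerivAt.comp z
        (mdifferentiableAt_extChartAt (I := cotangentModel SE) (mem_chart_source _ z)).hasMFDerivAt
      exact h6.mfderiv
    rw [hD]
    refine isLagrangian_comap hF _ ?_
    rw [mfderiv_extChartAt_self]
    exact Function.surjective_id

end Grassmannian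

end

theorem mainTheorem1 {V : Type*} [AddCommGroup V] [Module ℝ V] [FiniteDimensional ℝ V]
    (σ : SymplecticForm V) (L₀ : LagrangianGrassmannian σ) :
    maslovLift L₀ ⊆ puncturedCotangent (SymForms (halfDim V)) (LagrangianGrassmannian σ) ∧
    TotalSpace.proj '' maslovLift L₀ = maslovCycle L₀ ∧
    IsClosed (Subtype.val ⁻¹' maslovLift L₀ :
      Set (puncturedCotangent (SymForms (halfDim V)) (LagrangianGrassmannian σ))) ∧
    IsConic (maslovLift L₀) ∧
    IsLagrangianSubmanifold (maslovLift L₀) := by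
  refine ⟨fun z hz => (mem_maslovLift_iff.1 hz).2, ?_, ?_, ?_,
    isLagrangianSubmanifold_maslovLift L₀⟩
  · ext L
    constructor
    · rintro ⟨z, ⟨v, hv, h0, -⟩, rfl⟩
      exact (Submodule.ne_bot_iff _).2 ⟨v, hv, h0⟩
    · intro hL
      obtain ⟨v, hv, h0⟩ := (Submodule.ne_bot_iff _).1 hL
      exact ⟨⟨L, -symSquare L v⟩, ⟨v, hv, h0, rfl⟩, rfl⟩
  · have h : (Subtype.val ⁻¹' maslovLift L₀ :
        Set (puncturedCotangent (SymForms (halfDim V)) (LagrangianGrassmannian σ))) =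
        Subtype.val ⁻¹' closedMaslovLift L₀ := by
      ext z
      exact ⟨fun h => (mem_maslovLift_iff.1 h).1, fun h => mem_maslovLift_iff.2 ⟨h, z.2⟩⟩
    rw [h]
    exact (isClosed_closedMaslovLift L₀).preimage continuous_subtype_val
  · rintro z ⟨v, hv, h0, hz⟩ t ht
    refine ⟨Real.sqrt t • v, Submodule.smul_mem _ _ hv,
      smul_ne_zero (Real.sqrt_pos.2 ht).ne' h0, ?_⟩
    change t • z.2 = -symSquare z.1 (Real.sqrt t • v)
    rw [symSquare_smul, Real.sq_sqrt ht.le, hz, smul_neg]
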